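/- Let $E/\mathbb{Q}$ be a finite Galois extension with group $G=\mathrm{Gal}(E/\mathbb{Q})$. For each prime $p$ let $Q_p$ be a function with $Q_p(0)=1$ that is holomorphic on a branch cut of the open unit disk, save for a set $S_p$ of isolated singularities; that is, $Q_p$ is holomorphic on $\{|z|<1\}\setminus\Gamma_p$, where $\Gamma_p\supseteq S_p$ is the relatively closed set of cuts, $0\notin\Gamma_p$, and every point of $\Gamma_p$ has absolute value at least that of some point of $S_p$. Suppose that $p\mapsto Q_p$ is Frobenian with respect to $E/\mathbb{Q}$: there are a class function $c$ on $G$ and a finite set of primes $T$, containing those ramified in $E$, such that $Q_p=c(\mathrm{Fr}_p)$ for all $p\notin T$. Let $r$ be the smallest absolute value of an element of $\bigcup_p S_p$ (assumed attained), with $r=1$ if there are no singularities, and let $\mathcal{Q}(s)=\prod_p Q_p(p^{-s})$. For a representation $\rho:G\to\mathrm{GL}(V)$ let $L(s,\rho)=\prod_p\det(I-\rho(\mathrm{Fr}_p|V^{I_p})p^{-s})^{-1}$ be its Artin $L$-function on $\mathrm{Re}(s)>1$, and let $L(s,\rho)^{b}=\exp(b\log L(s,\rho))$, where $\log L(s,\rho)$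 is the holomorphic logarithm on $\mathrm{Re}(s)>1$ that tends to $0$ as $s\to+\infty$. (i) There are complex numbers $b_{n,\rho}$, indexed by the integers $n\ge1$ and the irreducible characters $\rho$ of $G$, such that for all but finitely many primes $p$ $$\log Q_p(z)=-\sum_{n\ge1}\sum_{\rho}b_{n,\rho}\log\det(I-\rho(\mathrm{Fr}_p)z^n)$$ as formal power series in $z$ (with $Q_p$ replaced by its Taylor series at $0$). (ii) For every family $(b_{n,\rho})$ as in (i) and every $\epsilon>0$, $$\mathcal{Q}(s)\prod_{p\le r^{-1/\epsilon}}Q_p(p^{-s})^{-1}\prod_{n\le1/\epsilon}\prod_\rho L(ns,\rho)^{-b_{n,\rho}}$$ is an absolutely convergent Dirichlet series (and so holomorphic) on $\mathrm{Re}(s)>\epsilon$. That is, there is a Dirichlet series $\sum_{m\ge1}a_m m^{-s}$ which converges absolutely and is holomorphic on $\mathrm{Re}(s)>\epsilon$, and which equals this expression for all $s$ with $\mathrm{Re}(s)>\max(1,\epsilon)$, where the products $\mathcal{Q}(s)$ and $L(ns,\rho)$ converge. Here the factors $Q_p(p^{-s})$ with $p\le r^{-1/\epsilon}$ are understood to be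 cancelled from $\mathcal{Q}(s)$, which agrees with the quotient wherever these factors are nonzero. -/

import Mathlib

open scoped NumberField Pointwise PowerSeries.WithPiTopology

noncomputable section

namespace FrobEuler

/-! ### Irreducible characters of a finite group -/

section IrreducibleCharacters

variable {G : Type*} [Group G]

/-- `χ` is the character of an irreducible finite-dimensional complex representation of `G`. -/
def IsIrredChar (χ : G → ℂ) : Prop :=
  ∃ (d : ℕ) (ρ : Representation ℂ G (Fin d → ℂ)), ρ.IsIrreducible ∧ ρ.character = χ

variable (G) in
/-- The set of irreducible complex characters of `G`. -/
abbrev IrrChar : Type _ := {χ : G → ℂ // IsIrredChar χ}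

/-- The degree of an irreducible character. -/
def IrrChar.deg (χ : IrrChar G) : ℕ := χ.2.choose

/-- An irreducible representation affording the irreducible character `χ`
(it is unique up to isomorphism when `G` is finite). -/
def IrrChar.rep (χ : IrrChar G) : Representation ℂ G (Fin χ.deg → ℂ) := χ.2.choose_spec.choose

theorem IrrChar.rep_irreducible (χ : IrrChar G) : χ.rep.IsIrreducible :=
  χ.2.choose_spec.choose_spec.1

theorem IrrChar.rep_character (χ : IrrChar G) : χ.rep.character = χ.1 :=
  χ.2.choose_spec.choose_spec.2

/-- A finite group has finitely many irreducible characters, since they are orthonormal. -/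
instance [Finite G] : Finite (IrrChar G) := by
  classical
  have := Fintype.ofFinite G
  have hc : (Nat.card G : ℂ) ≠ 0 := by simp
  have : Invertible (Nat.card G : ℂ) := invertibleOfNonzero hc
  have horth (χ ψ : IrrChar G) :
      (Nat.card G : ℂ)⁻¹ * ∑ g : G, χ.1 g * ψ.1 g⁻¹ = if χ = ψ then 1 else 0 := by
    have := χ.rep_irreducible
    have := ψ.rep_irreducible
    have h := Representation.char_orthonormal χ.rep ψ.rep
    rw [χ.rep_character, ψ.rep_character] at h
    rw [h]
    by_cases hχ : χ = ψ
    · subst hχ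
      rw [if_pos ⟨Representation.Equiv.refl _⟩, if_pos rfl]
    · rw [if_neg hχ, if_neg]
      rintro ⟨e⟩
      refine hχ (Subtype.ext ?_)
      rw [← χ.rep_character, ← ψ.rep_character, Representation.char_iso e]
  have hli : LinearIndependent ℂ (fun χ : IrrChar G => (χ.1 : G → ℂ)) := by
    rw [linearIndependent_iff']
    intro s c hs ψ hψ
    have h1 : ∑ χ ∈ s, c χ * ((Nat.card G : ℂ)⁻¹ * ∑ g : G, χ.1 g * ψ.1 g⁻¹) = 0 := by
      have h2 (g : G) : ∑ χ ∈ s, c χ * χ.1 g = 0 := by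
        simpa using congrFun hs g
      calc _ = (Nat.card G : ℂ)⁻¹ * ∑ g : G, (∑ χ ∈ s, c χ * χ.1 g) * ψ.1 g⁻¹ := by
            simp only [Finset.mul_sum, Finset.sum_mul]
            rw [Finset.sum_comm]
            refine Finset.sum_congr rfl fun g _ => Finset.sum_congr rfl fun χ _ => ?_
            ring
        _ = 0 := by simp [h2]
    simp only [horth] at h1
    simpa [hψ] using h1
  exact hli.finite

instance [Finite G] : Fintype (IrrChar G) := Fintype.ofFinite _

end IrreducibleCharacters

/-! ### Frobenius elements and Frobenian functions -/

section Frobenian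

/-- The polynomial `det (I - f z)` in the variable `z`, for an endomorphism `f` of a
finite-dimensional complex vector space. -/
def detOneSub {V : Type*} [AddCommGroup V] [Module ℂ V] [FiniteDimensional ℂ V]
    (f : V →ₗ[ℂ] V) : Polynomial ℂ :=
  (LinearMap.toMatrix (Module.finBasis ℂ V) (Module.finBasis ℂ V) f).charpolyRev

variable (E : Type*) [Field E] [NumberField E]

/-- `𝔓` is a prime of the ring of integers of `E` above the rational prime `p`. -/
def IsPrimeAbove (p : Nat.Primes) (𝔓 : Ideal (𝓞 E)) : Prop :=
  𝔓.IsPrime ∧ 𝔓.LiesOver (Ideal.span {((p : ℕ) : ℤ)})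

/-- `σ` belongs to the Frobenius class `Fr_p`: it is an (arithmetic) Frobenius element at some
prime of `E` above `p`. For `p` unramified in `E` such `σ` form one conjugacy class,
the image of `p` under the Artin map. -/
def IsFrobeniusOver (p : Nat.Primes) (σ : Gal(E/ℚ)) : Prop :=
  ∃ 𝔓 : Ideal (𝓞 E), IsPrimeAbove E p 𝔓 ∧ IsArithFrobAt ℤ σ 𝔓

/-- `f` is Frobenian with respect to `E/ℚ`: outside a finite set of primes containing the
ramified ones it is the composition of the Artin map with a class function. -/
def IsFrobenian {A : Type*} (f : Nat.Primes → A) : Prop :=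
  ∃ (T : Set Nat.Primes) (c : Gal(E/ℚ) → A), T.Finite ∧ (∀ g h, c (h * g * h⁻¹) = c g) ∧
    ∀ p ∉ T, Algebra.IsUnramifiedIn (𝓞 E) (Ideal.span {((p : ℕ) : ℤ)}) ∧
      ∀ σ, IsFrobeniusOver E p σ → f p = c σ

end Frobenian

/-! ### Artin `L`-functions -/

section Artin

variable (E : Type*) [Field E] [NumberField E]

theorem exists_prime_frobenius [IsGalois ℚ E] (p : Nat.Primes) :
    ∃ x : Ideal (𝓞 E) × Gal(E/ℚ), IsPrimeAbove E p x.1 ∧ IsArithFrobAt ℤ x.2 x.1 := by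
  have hp : (Ideal.span {((p : ℕ) : ℤ)}).IsPrime := by
    rw [Ideal.span_singleton_prime (by exact_mod_cast p.2.ne_zero)]
    exact Nat.prime_iff_prime_int.mp p.2
  obtain ⟨𝔓, h1, h2⟩ :=
    (inferInstance : Nonempty (Ideal.primesOver (Ideal.span {((p : ℕ) : ℤ)}) (𝓞 E)))
  have hne : 𝔓 ≠ ⊥ := Ideal.ne_bot_of_liesOver_of_ne_bot
    (p := Ideal.span {((p : ℕ) : ℤ)}) (by simpa using p.2.ne_zero) 𝔓
  have : Finite (𝓞 E ⧸ 𝔓) := Ring.HasFiniteQuotients.finiteQuotient hne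
  obtain ⟨σ, hσ⟩ := IsArithFrobAt.exists_of_isInvariant ℤ Gal(E/ℚ) 𝔓
  exact ⟨(𝔓, σ), ⟨h1, h2⟩, hσ⟩

variable [IsGalois ℚ E]

/-- A chosen prime of `E` above `p`. -/
def primeAbove (p : Nat.Primes) : Ideal (𝓞 E) := (exists_prime_frobenius E p).choose.1

/-- A Frobenius element at the chosen prime of `E` above `p`. -/
def frobAbove (p : Nat.Primes) : Gal(E/ℚ) := (exists_prime_frobenius E p).choose.2

theorem primeAbove_spec (p : Nat.Primes) : IsPrimeAbove E p (primeAbove E p) :=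
  (exists_prime_frobenius E p).choose_spec.1

theorem frobAbove_spec (p : Nat.Primes) : IsArithFrobAt ℤ (frobAbove E p) (primeAbove E p) :=
  (exists_prime_frobenius E p).choose_spec.2

variable {E} {V : Type*} [AddCommGroup V] [Module ℂ V]

/-- The subspace `V^{I_p}` of vectors fixed by the inertia group at the chosen prime above `p`. -/
def inertiaInvariants (ρ : Representation ℂ Gal(E/ℚ) V) (p : Nat.Primes) : Submodule ℂ V where
  carrier := {v | ∀ g ∈ (primeAbove E p).inertia Gal(E/ℚ), ρ g v = v}
  add_mem' hv hw g hg := by rw [map_add, hv g hg, hw g hg]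
  zero_mem' g _ := map_zero _
  smul_mem' c v hv g hg := by rw [map_smul, hv g hg]

theorem frob_mapsTo (ρ : Representation ℂ Gal(E/ℚ) V) (p : Nat.Primes) :
    ∀ v ∈ inertiaInvariants ρ p, ρ (frobAbove E p) v ∈ inertiaInvariants ρ p := by
  intro v hv g hg
  have := (primeAbove_spec E p).1
  have hst := IsArithFrobAt.mem_stabilizer (frobAbove_spec E p)
  have hst' : (frobAbove E p)⁻¹ • primeAbove E p = primeAbove E p := by
    rw [inv_smul_eq_iff]; exact (MulAction.mem_stabilizer_iff.mp hst).symm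
  have hn : (frobAbove E p)⁻¹ * g * frobAbove E p ∈ (primeAbove E p).inertia Gal(E/ℚ) := by
    intro x
    have h1 := Ideal.smul_mem_pointwise_smul (frobAbove E p)⁻¹ _ _ (hg (frobAbove E p • x))
    rw [hst', smul_sub, inv_smul_smul] at h1
    rwa [mul_smul, mul_smul]
  have h := hv _ hn
  calc ρ g (ρ (frobAbove E p) v)
      = ρ (frobAbove E p) (ρ ((frobAbove E p)⁻¹ * g * frobAbove E p) v) := by
        rw [← Module.End.mul_apply, ← Module.End.mul_apply, ← map_mul, ← map_mul]
        congr 2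
        group
    _ = ρ (frobAbove E p) v := by rw [h]

variable [FiniteDimensional ℂ V]

/-- The polynomial `det (I - ρ(Fr_p | V^{I_p}) z)`; it does not depend on the chosen
prime above `p` and the chosen Frobenius element. -/
def artinPoly (ρ : Representation ℂ Gal(E/ℚ) V) (p : Nat.Primes) : Polynomial ℂ :=
  detOneSub ((ρ (frobAbove E p)).restrict (frob_mapsTo ρ p))

/-- The Euler factor `det (I - ρ(Fr_p | V^{I_p}) p^{-s})⁻¹`. -/
def artinFactor (ρ : Representation ℂ Gal(E/ℚ) V) (p : Nat.Primes) (s : ℂ) : ℂ :=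
  ((artinPoly ρ p).eval ((p : ℂ) ^ (-s)))⁻¹

/-- The Artin `L`-function `L(s, ρ)` as an Euler product, for `Re s > 1`. -/
def artinL (ρ : Representation ℂ Gal(E/ℚ) V) (s : ℂ) : ℂ :=
  ∏' p : Nat.Primes, artinFactor ρ p s

/-- `ℓ` is the standard branch of `log L(s, ρ)` on `Re s > 1`: the holomorphic logarithm of the
convergent Euler product `L(s, ρ)` which tends to `0` as `s → +∞` along the reals.
On `Re s > 1` it is unique, and complex powers are `L(s, ρ)^b = exp (b ℓ(s))`. -/
structure IsLogArtinL (ρ : Representation ℂ Gal(E/ℚ) V) (ℓ : ℂ → ℂ) : Prop where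
  differentiableOn : DifferentiableOn ℂ ℓ {s | 1 < s.re}
  multipliable : ∀ s : ℂ, 1 < s.re → Multipliable fun p => artinFactor ρ p s
  exp_eq : ∀ s : ℂ, 1 < s.re → Complex.exp (ℓ s) = artinL ρ s
  tendsto : Filter.Tendsto (fun x : ℝ => ℓ x) Filter.atTop (nhds 0)

end Artin

/-! ### The Euler factors `Q_p` -/

/-- `f` is holomorphic on the cut open unit disk `{|z| < 1} \ Γ`, where `S` is the set of
(isolated) singularities and `Γ ⊇ S` is the relatively closed set of cuts. The cuts issue from
singularities and stay at least as far from `0`: no point of `Γ` is closer to `0`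
than all of `S`. The origin is not on a cut. -/
structure IsHolomorphicOnCutDisk (f : ℂ → ℂ) (S Γ : Set ℂ) : Prop where
  sing_subset : S ⊆ Γ
  cut_subset : Γ ⊆ Metric.ball 0 1
  zero_notMem : (0 : ℂ) ∉ Γ
  isolated : ∀ z ∈ Metric.ball (0 : ℂ) 1, ¬ AccPt z (Filter.principal S)
  isOpen_compl : IsOpen (Metric.ball (0 : ℂ) 1 \ Γ)
  outward : ∀ w ∈ Γ, ∃ a ∈ S, ‖a‖ ≤ ‖w‖
  differentiableOn : DifferentiableOn ℂ f (Metric.ball (0 : ℂ) 1 \ Γ)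

/-- The Taylor series of `f` at `0`, as a formal power series. -/
def taylorSeries (f : ℂ → ℂ) : PowerSeries ℂ :=
  PowerSeries.mk fun n => iteratedDeriv n f 0 / (n.factorial : ℂ)

theorem finite_primes_le (x : ℝ) : {p : Nat.Primes | ((p : ℕ) : ℝ) ≤ x}.Finite :=
  Set.Finite.of_finite_image (f := fun p : Nat.Primes => (p : ℕ))
    ((Set.finite_le_nat ⌊x⌋₊).subset (by rintro _ ⟨p, hp, rfl⟩; exact Nat.le_floor hp))
    Nat.Primes.coe_nat_injective.injOn

/-- The finite set of primes `p ≤ x`. -/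
def primesLE (x : ℝ) : Finset Nat.Primes := (finite_primes_le x).toFinset

theorem mem_primesLE {x : ℝ} {p : Nat.Primes} : p ∈ primesLE x ↔ ((p : ℕ) : ℝ) ≤ x := by
  rw [primesLE, Set.Finite.mem_toFinset, Set.mem_ofPred_eq]

/-- The family of coefficients `b n χ` (`n ≥ 1`, `χ` irreducible) satisfies, for all but finitely
many primes `p`, the identity of formal power series
`log Q_p(z) = - ∑_{n ≥ 1, χ} b n χ * log det (I - χ(Fr_p) z ^ n)`. -/
def IsLogDecomposition (E : Type*) [Field E] [NumberField E] (Q : Nat.Primes → ℂ → ℂ)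
    (b : ℕ → IrrChar Gal(E/ℚ) → ℂ) : Prop :=
  ∀ᶠ p : Nat.Primes in Filter.cofinite, ∀ σ : Gal(E/ℚ), IsFrobeniusOver E p σ →
    HasSum
      (fun i : ℕ+ × IrrChar Gal(E/ℚ) =>
        -(b i.1 i.2 • PowerSeries.logOf
          (((detOneSub (i.2.rep σ)).comp (Polynomial.X ^ (i.1 : ℕ)) : Polynomial ℂ) :
            PowerSeries ℂ)))
      (PowerSeries.logOf (taylorSeries (Q p)))

end FrobEuler

end

/-! Part (i) is linear algebra in each degree. Class functions are combinations of irreducible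
characters (`exists_eq_sum_irrChar`), and `-log det (I - χ(g) z ^ n)` begins with `χ(g) z ^ n`. Once
the `b n` with `n < k` are known, what is left in degree `k` is a class function of `g`, and its
coordinates are the `b k` (`logCoeff`, `hasSum_logCoeff`).

For (ii), everything is gathered into one Euler product. With `N = ⌊1/ε⌋`, the factor at `p` is
`F_p(z) = Q_p(z) * exp (∑ n ≤ N, ∑ χ, b n χ * log det (I - χ(Fr_p) z ^ n))` at `z = p ^ (-s)`, with
`Q_p` replaced by `1` when `p ≤ r ^ (-1/ε)`. For almost all `p` the decomposition cancels `log F_p`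
through degree `N`, so `F_p = 1 + O(z ^ (N + 1))`. Outside a finite set of primes only finitely many
functions `F_p` occur, so the implied constant is uniform (`summable_taylorTail`), and `∑ p ^ (-(N +
1) Re s)` converges for `Re s > ε` because `(N + 1) ε > 1`.

For the primes kept, `p ^ (-s)` lies in the disk of radius `r`, on which `Q_p` is holomorphic. Each
factor therefore equals its Taylor series, and multiplying out gives an absolutely convergent
Dirichlet series (`lseries_eulerCoeff`). On `Re s > 1` the product splits back into the `Q_p` and
the powers of `L(ns, χ)` (`hasProd_exp_localExponent`). The logarithms used are holomorphic on the
unit disk because Frobenius has finite order, which puts the roots of its polynomial on the unit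
circle. -/

noncomputable section

namespace FrobEuler

/-! ### Irreducible characters span the class functions. -/

section ClassFunctions

open MonoidAlgebra

variable {G : Type*} [Group G]

/-- The trace of the action of the group on a finite-dimensional simple module over the group
algebra is an irreducible character. -/
theorem exists_irrChar_of_isSimpleModule (M : Type*) [AddCommGroup M] [Module ℂ M]
    [Module ℂ[G] M] [IsScalarTower ℂ ℂ[G] M] [FiniteDimensional ℂ M] [IsSimpleModule ℂ[G] M] :
    ∃ χ : IrrChar G, ∀ g, χ.1 g =
      LinearMap.trace ℂ M (Algebra.lsmul ℂ ℂ M (MonoidAlgebra.single g (1 : ℂ))) := by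
  let e : M ≃ₗ[ℂ] (Fin (Module.finrank ℂ M) → ℂ) :=
    LinearEquiv.ofFinrankEq _ _ (by simp)
  let ρ : Representation ℂ G (Fin (Module.finrank ℂ M) → ℂ) :=
    ((e.conjAlgEquiv ℂ : Module.End ℂ M ≃ₐ[ℂ] _) : Module.End ℂ M →* _).comp (Representation.ofModule' M)
  have hρ (g : G) : ρ g = e.conj (Algebra.lsmul ℂ ℂ M (MonoidAlgebra.single g (1 : ℂ))) := rfl
  -- The coordinates carry the group action along, so simplicity of `M` passes to `ρ`.
  let e' : M ≃ₗ[ℂ[G]] ρ.asModule :=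
    { e.toAddEquiv.trans ρ.asModuleEquiv.symm.toAddEquiv with
      map_smul' := fun m v => by
        change ρ.asModuleEquiv.symm (e (m • v)) = m • ρ.asModuleEquiv.symm (e v)
        induction m using MonoidAlgebra.induction_linear with
        | zero => simp
        | add x y hx hy => rw [add_smul, add_smul, map_add, map_add, hx, hy]
        | single g a =>
          have h1 : (MonoidAlgebra.single g a : ℂ[G]) = a • MonoidAlgebra.single g 1 := by simp
          rw [h1, smul_assoc, smul_assoc, map_smul, map_smul, Representation.single_smul, one_smul]
          congr 1
          change e _ = ρ g (e v)
          rw [hρ]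
          simp [LinearEquiv.conj_apply] }
  have hirr : ρ.IsIrreducible := by
    rw [Representation.irreducible_iff_isSimpleModule_asModule]
    exact IsSimpleModule.congr e'.symm
  refine ⟨⟨ρ.character, _, ρ, hirr, rfl⟩, fun g => ?_⟩
  change LinearMap.trace ℂ _ (ρ g) = _
  rw [hρ, LinearMap.trace_conj']

/-- Since `f` is a class function, the element is central and acts by a scalar by Schur's lemma. The
trace of this action is one of the sums assumed to vanish, and the dimension is nonzero in `ℂ`, so
the scalar is zero. -/
theorem smul_eq_zero_of_isSimpleModule [Fintype G] {f : G → ℂ}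
    (hf : ∀ g h, f (h * g * h⁻¹) = f g) (h0 : ∀ χ : IrrChar G, ∑ g, f g * χ.1 g⁻¹ = 0)
    (M : Type*) [AddCommGroup M] [Module ℂ M]
    [Module ℂ[G] M] [IsScalarTower ℂ ℂ[G] M] [FiniteDimensional ℂ M] [IsSimpleModule ℂ[G] M]
    (m : M) : (∑ g, MonoidAlgebra.single g⁻¹ (f g) : ℂ[G]) • m = 0 := by
  set z : ℂ[G] := ∑ g, MonoidAlgebra.single g⁻¹ (f g) with hz
  have hcomm (x : ℂ[G]) : z * x = x * z := by
    induction x using MonoidAlgebra.induction_linear with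
    | zero => simp
    | add x y hx hy => rw [mul_add, add_mul, hx, hy]
    | single h a =>
      simp only [hz, Finset.sum_mul, Finset.mul_sum, MonoidAlgebra.single_mul_single]
      refine Fintype.sum_equiv (MulAut.conj h⁻¹).toEquiv _ _ fun g => ?_
      have := hf g h⁻¹
      simp only [inv_inv] at this
      have h2 : f (h⁻¹ * (g * h)) = f g := by rw [← mul_assoc, this]
      simp [h2, mul_assoc, mul_comm]
  let T : Module.End ℂ[G] M :=
    { toFun := fun v => z • v
      map_add' := smul_add z
      map_smul' := fun x v => by simp [smul_smul, hcomm] }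
  obtain ⟨c, hc⟩ := (IsSimpleModule.algebraMap_end_bijective_of_isAlgClosed (A := ℂ[G])
    (V := M) ℂ).2 T
  have hcv (v : M) : z • v = c • v := by
    have := LinearMap.congr_fun hc v
    simpa [T, Module.algebraMap_end_apply] using this.symm
  obtain ⟨χ, hχ⟩ := exists_irrChar_of_isSimpleModule (G := G) M
  have htr : LinearMap.trace ℂ M (Algebra.lsmul ℂ ℂ M z) = 0 := by
    rw [← h0 χ, hz, map_sum, map_sum]
    refine Finset.sum_congr rfl fun g _ => ?_
    rw [hχ, ← smul_eq_mul, ← map_smul, ← map_smul]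
    simp
  have hTz : Algebra.lsmul ℂ ℂ M z = c • LinearMap.id := by
    ext v; simpa using hcv v
  rw [hTz, map_smul, LinearMap.trace_id, smul_eq_mul, mul_eq_zero] at htr
  have : Nontrivial M := IsSimpleModule.nontrivial ℂ[G] M
  rcases htr with h | h
  · rw [hcv, h, zero_smul]
  · exact absurd (Nat.cast_eq_zero.mp h) Module.finrank_pos.ne'

/-- A class function orthogonal to all irreducible characters vanishes. -/
theorem eq_zero_of_orthogonal_irrChar [Fintype G] {f : G → ℂ}
    (hf : ∀ g h, f (h * g * h⁻¹) = f g) (h0 : ∀ χ : IrrChar G, ∑ g, f g * χ.1 g⁻¹ = 0) :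
    f = 0 := by
  -- This is Maschke's condition: the regular module is then a sum of simple submodules, each killed
  -- by `z`, whence `z = z * 1 = 0`.
  have : NeZero (Nat.card G : ℂ) := ⟨by simp⟩
  set z : ℂ[G] := ∑ g, MonoidAlgebra.single g⁻¹ (f g) with hz
  have hall : ∀ x : ℂ[G], z * x = 0 := by
    intro x
    have hx : x ∈ sSup {m : Submodule ℂ[G] ℂ[G] | IsSimpleModule ℂ[G] m} := by
      rw [IsSemisimpleModule.sSup_simples_eq_top]; trivial
    rw [sSup_eq_iSup'] at hx
    induction hx using Submodule.iSup_induction' with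
    | mem i x hx =>
      have : IsSimpleModule ℂ[G] i.1 := i.2
      have h := smul_eq_zero_of_isSimpleModule hf h0 i.1 ⟨x, hx⟩
      exact congrArg Subtype.val h
    | zero => simp
    | add x y _ _ hx hy => rw [mul_add, hx, hy, add_zero]
  have h1 : z = 0 := by simpa using hall 1
  funext g
  have h2 : z.coeff g⁻¹ = 0 := by rw [h1]; rfl
  classical
  simpa [hz, MonoidAlgebra.coeff_sum, Finsupp.finsetSum_apply, Finsupp.single_apply] using h2

/-- The irreducible characters of a finite group span the space of class functions. -/
theorem exists_eq_sum_irrChar [Finite G] {f : G → ℂ} (hf : ∀ g h, f (h * g * h⁻¹) = f g) :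
    ∃ b : IrrChar G → ℂ, ∀ g, f g = ∑ χ, b χ * χ.1 g := by
  classical
  have := Fintype.ofFinite G
  have hc : (Nat.card G : ℂ) ≠ 0 := by simp
  have : Invertible (Nat.card G : ℂ) := invertibleOfNonzero hc
  have horth (χ ψ : IrrChar G) :
      (Nat.card G : ℂ)⁻¹ * ∑ g : G, χ.1 g * ψ.1 g⁻¹ = if χ = ψ then 1 else 0 := by
    have := χ.rep_irreducible
    have := ψ.rep_irreducible
    have h := Representation.char_orthonormal χ.rep ψ.rep
    rw [χ.rep_character, ψ.rep_character] at h
    rw [h]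
    by_cases hχ : χ = ψ
    · subst hχ
      rw [if_pos ⟨Representation.Equiv.refl _⟩, if_pos rfl]
    · rw [if_neg hχ, if_neg]
      rintro ⟨e⟩
      refine hχ (Subtype.ext ?_)
      rw [← χ.rep_character, ← ψ.rep_character, Representation.char_iso e]
  let b : IrrChar G → ℂ := fun χ => (Nat.card G : ℂ)⁻¹ * ∑ g, f g * χ.1 g⁻¹
  have hclass (χ : IrrChar G) (g h : G) : χ.1 (h * g * h⁻¹) = χ.1 g := by
    rw [← χ.rep_character]; exact Representation.char_conj χ.rep g h
  -- Subtracting the orthogonal projection leaves a class function orthogonal to every irreducible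
  -- character.
  have key : (fun g => f g - ∑ χ, b χ * χ.1 g) = 0 := by
    refine eq_zero_of_orthogonal_irrChar (fun g h => by simp only [hf, hclass]) fun ψ => ?_
    have h2 : ∑ g, (∑ χ, b χ * χ.1 g) * ψ.1 g⁻¹ = Nat.card G * b ψ := by
      calc _ = ∑ χ, b χ * (Nat.card G * ((Nat.card G : ℂ)⁻¹ * ∑ g, χ.1 g * ψ.1 g⁻¹)) := by
            simp only [mul_inv_cancel_left₀ hc, Finset.mul_sum, Finset.sum_mul]
            rw [Finset.sum_comm]
            simp only [mul_assoc]
        _ = _ := by simp only [horth]; simp [mul_comm]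
    simp only [sub_mul, Finset.sum_sub_distrib, h2, b, mul_inv_cancel_left₀ hc, sub_self]
  exact ⟨b, fun g => sub_eq_zero.mp (congrFun key g)⟩

end ClassFunctions

/-! ### Taylor series and formal logarithms. -/

section TaylorSeries

open Filter Topology PowerSeries

theorem coeff_taylorSeries (f : ℂ → ℂ) (n : ℕ) :
    coeff n (taylorSeries f) = iteratedDeriv n f 0 / (n.factorial : ℂ) := coeff_mk _ _

theorem constantCoeff_taylorSeries (f : ℂ → ℂ) : constantCoeff (taylorSeries f) = f 0 := by
  rw [← coeff_zero_eq_constantCoeff_apply, coeff_taylorSeries]; simp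

theorem taylorSeries_congr {f g : ℂ → ℂ} (h : f =ᶠ[𝓝 0] g) : taylorSeries f = taylorSeries g := by
  ext n; rw [coeff_taylorSeries, coeff_taylorSeries, h.iteratedDeriv_eq]

theorem taylorSeries_add {f g : ℂ → ℂ} (hf : AnalyticAt ℂ f 0) (hg : AnalyticAt ℂ g 0) :
    taylorSeries (fun z => f z + g z) = taylorSeries f + taylorSeries g := by
  ext n
  rw [map_add, coeff_taylorSeries, coeff_taylorSeries, coeff_taylorSeries,
    iteratedDeriv_fun_add hf.contDiffAt hg.contDiffAt, add_div]

theorem taylorSeries_const_mul (c : ℂ) (f : ℂ → ℂ) :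
    taylorSeries (fun z => c * f z) = c • taylorSeries f := by
  ext n
  rw [coeff_smul, coeff_taylorSeries, coeff_taylorSeries,
    iteratedDeriv_const_mul_field, smul_eq_mul, mul_div_assoc]

theorem taylorSeries_const (c : ℂ) : taylorSeries (fun _ => c) = C c := by
  ext n
  rw [coeff_taylorSeries, iteratedDeriv_const, coeff_C]
  split_ifs with h <;> simp [h]

theorem taylorSeries_sum {ι : Type*} (s : Finset ι) {f : ι → ℂ → ℂ}
    (hf : ∀ i ∈ s, AnalyticAt ℂ (f i) 0) :
    taylorSeries (fun z => ∑ i ∈ s, f i z) = ∑ i ∈ s, taylorSeries (f i) := by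
  classical
  induction s using Finset.induction_on with
  | empty => simp [taylorSeries_const]
  | insert a s ha ih =>
    simp only [Finset.sum_insert ha]
    rw [taylorSeries_add (hf a (by simp))
      (Finset.analyticAt_fun_sum s fun i hi => hf i (by simp [hi])),
      ih fun i hi => hf i (by simp [hi])]

theorem taylorSeries_mul {f g : ℂ → ℂ} (hf : AnalyticAt ℂ f 0) (hg : AnalyticAt ℂ g 0) :
    taylorSeries (fun z => f z * g z) = taylorSeries f * taylorSeries g := by
  ext n
  rw [coeff_taylorSeries, iteratedDeriv_fun_mul hf.contDiffAt hg.contDiffAt, coeff_mul,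
    Finset.Nat.sum_antidiagonal_eq_sum_range_succ_mk, Finset.sum_div]
  refine Finset.sum_congr rfl fun i hi => ?_
  have hi : i ≤ n := Nat.lt_succ_iff.mp (Finset.mem_range.mp hi)
  rw [coeff_taylorSeries, coeff_taylorSeries, Nat.cast_choose ℂ hi]
  have := Nat.cast_ne_zero (R := ℂ).mpr n.factorial_ne_zero
  field_simp

theorem taylorSeries_deriv (f : ℂ → ℂ) :
    taylorSeries (deriv f) = d⁄dX ℂ (taylorSeries f) := by
  ext n
  rw [coeff_derivative, coeff_taylorSeries, coeff_taylorSeries, iteratedDeriv_succ',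
    Nat.factorial_succ]
  push_cast
  have : (n : ℂ) + 1 ≠ 0 := by exact_mod_cast n.succ_ne_zero
  field_simp

theorem taylorSeries_id : taylorSeries (fun z => z) = X := by
  ext n
  rw [coeff_taylorSeries, iteratedDeriv_fun_id_zero, coeff_X]
  split_ifs with h <;> simp [h]

theorem taylorSeries_eval (P : Polynomial ℂ) : taylorSeries (fun z => P.eval z) = P := by
  have han (P : Polynomial ℂ) : AnalyticAt ℂ (fun z => P.eval z) 0 :=
    (P.differentiable.analyticAt 0)
  induction P using Polynomial.induction_on with
  | C a => simp [taylorSeries_const]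
  | add p q hp hq =>
    simp only [Polynomial.eval_add, taylorSeries_add (han p) (han q), hp, hq, Polynomial.coe_add]
  | monomial n a h =>
    have h2 : (fun z : ℂ => (Polynomial.C a * Polynomial.X ^ (n + 1)).eval z) =
        fun z => (Polynomial.C a * Polynomial.X ^ n).eval z * z := by
      funext z; simp; ring
    rw [h2, taylorSeries_mul (g := fun z => z) (han _) analyticAt_id, h, taylorSeries_id,
      pow_succ, ← mul_assoc, Polynomial.coe_mul (_ * _) Polynomial.X, Polynomial.coe_X]

theorem derivative_logOf_mul {f : ℂ⟦X⟧} (hf : constantCoeff f = 1) :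
    d⁄dX ℂ (logOf f) * f = d⁄dX ℂ f := by
  have hs : HasSubst (f - 1) := HasSubst.of_constantCoeff_zero' (by simp [hf])
  have h1 : d⁄dX ℂ (log ℂ) * (1 + X) = 1 := by
    rw [deriv_log]
    ext n
    rw [mul_add, mul_one, map_add]
    rcases n with _ | n
    · simp
    · rw [coeff_succ_mul_X]; simp [pow_succ, coeff_one]
  have h2 := congrArg (PowerSeries.subst (f - 1)) h1
  rw [← coe_substAlgHom hs, map_mul, map_add, map_one, coe_substAlgHom hs, subst_X hs,
    add_sub_cancel] at h2
  rw [logOf_eq, derivative_subst hs]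
  calc _ = (d⁄dX ℂ (log ℂ)).subst (f - 1) * f * d⁄dX ℂ (f - 1) := by ring
    _ = _ := by rw [h2]; simp

/-- The differential equation `P' = L' P` replaces composition with the exponential series in all
coefficient comparisons. -/
theorem derivative_taylorSeries_of_exp_eq {P L : ℂ → ℂ} (hL : AnalyticAt ℂ L 0)
    (h : ∀ᶠ z in 𝓝 0, Complex.exp (L z) = P z) :
    d⁄dX ℂ (taylorSeries P) = d⁄dX ℂ (taylorSeries L) * taylorSeries P := by
  have hP : AnalyticAt ℂ P 0 := hL.cexp.congr h
  rw [← taylorSeries_deriv, ← taylorSeries_deriv, ← taylorSeries_mul hL.deriv hP]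
  refine taylorSeries_congr ?_
  have h' : (fun z => Complex.exp (L z)) =ᶠ[𝓝 0] P := h
  filter_upwards [h'.deriv, h, hL.eventually_analyticAt] with z h1 h2 h3
  rw [← h1, ← h2, mul_comm]
  exact h3.differentiableAt.hasDerivAt.cexp.deriv

/-- The Taylor series of a holomorphic logarithm is the formal logarithm of the Taylor series. -/
theorem logOf_taylorSeries {P L : ℂ → ℂ} (hL : AnalyticAt ℂ L 0) (hL0 : L 0 = 0)
    (h : ∀ᶠ z in 𝓝 0, Complex.exp (L z) = P z) : logOf (taylorSeries P) = taylorSeries L := by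
  have hP0 : P 0 = 1 := by rw [← h.self_of_nhds, hL0, Complex.exp_zero]
  have hc : constantCoeff (taylorSeries P) = 1 := by rw [constantCoeff_taylorSeries, hP0]
  refine derivative.ext ?_ (by rw [constantCoeff_logOf hc, constantCoeff_taylorSeries, hL0])
  have hne : taylorSeries P ≠ 0 := by
    intro h0; rw [h0] at hc; simp at hc
  refine mul_right_cancel₀ hne ?_
  rw [derivative_logOf_mul hc, derivative_taylorSeries_of_exp_eq hL h]

/-- If the first coefficients of `L` at `0` vanish, so do those of `exp ∘ L`, apart from the
constant one. -/
theorem coeff_taylorSeries_exp_eq_zero {P L : ℂ → ℂ} (hL : AnalyticAt ℂ L 0)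
    (h : ∀ᶠ z in 𝓝 0, Complex.exp (L z) = P z) {N : ℕ}
    (h0 : ∀ k ≤ N, coeff k (taylorSeries L) = 0) {k : ℕ} (hk : 1 ≤ k) (hkN : k ≤ N) :
    coeff k (taylorSeries P) = 0 := by
  have hmul := derivative_taylorSeries_of_exp_eq hL h
  obtain ⟨k, rfl⟩ : ∃ j, k = j + 1 := ⟨k - 1, by omega⟩
  have h1 := congrArg (coeff k) hmul
  rw [coeff_derivative, coeff_mul, Finset.sum_eq_zero] at h1
  · rcases mul_eq_zero.mp h1 with h2 | h2
    · exact h2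
    · exact absurd h2 (by exact_mod_cast k.succ_ne_zero)
  · intro ij hij
    have := Finset.HasAntidiagonal.mem_antidiagonal.mp hij
    rw [coeff_derivative, h0 _ (by omega)]
    ring

end TaylorSeries

/-! ### The polynomial `det (I - f z)` and its roots. -/

section DetOneSub

variable {V : Type*} [AddCommGroup V] [Module ℂ V] [FiniteDimensional ℂ V]

theorem detOneSub_eq_reverse_charpoly (f : V →ₗ[ℂ] V) : detOneSub f = f.charpoly.reverse := by
  rw [detOneSub, ← Matrix.reverse_charpoly, LinearMap.charpoly_toMatrix]

theorem detOneSub_conj {W : Type*} [AddCommGroup W] [Module ℂ W] [FiniteDimensional ℂ W]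
    (e : V ≃ₗ[ℂ] W) (f : V →ₗ[ℂ] V) : detOneSub (e.conj f) = detOneSub f := by
  rw [detOneSub_eq_reverse_charpoly, detOneSub_eq_reverse_charpoly, LinearEquiv.charpoly_conj]

theorem natDegree_detOneSub_le (f : V →ₗ[ℂ] V) :
    (detOneSub f).natDegree ≤ Module.finrank ℂ V := by
  rw [detOneSub_eq_reverse_charpoly, ← LinearMap.charpoly_natDegree f]
  exact Polynomial.reverse_natDegree_le _

theorem eval_zero_detOneSub (f : V →ₗ[ℂ] V) : (detOneSub f).eval 0 = 1 :=
  Matrix.eval_charpolyRev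

theorem coeff_one_detOneSub (f : V →ₗ[ℂ] V) :
    (detOneSub f).coeff 1 = -LinearMap.trace ℂ V f := by
  rw [detOneSub, Matrix.coeff_charpolyRev_eq_neg_trace,
    LinearMap.trace_eq_matrix_trace ℂ (Module.finBasis ℂ V)]

theorem eval_charpolyRev_eq_det {n : Type*} [Fintype n] [DecidableEq n] (M : Matrix n n ℂ)
    (z : ℂ) : M.charpolyRev.eval z = (1 - z • M).det := by
  rw [Matrix.charpolyRev, ← Polynomial.coe_evalRingHom, RingHom.map_det]
  congr 1
  ext i j
  rcases eq_or_ne i j with hij | hij <;> simp [hij, mul_comm z]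

/-- The roots of `det (I - f z)` lie on the unit circle when `f` has finite order. -/
theorem norm_eq_one_of_isRoot_detOneSub {f : V →ₗ[ℂ] V} {m : ℕ} (hm : m ≠ 0) (hf : f ^ m = 1)
    {z : ℂ} (hz : (detOneSub f).IsRoot z) : ‖z‖ = 1 := by
  rw [Polynomial.IsRoot, detOneSub, eval_charpolyRev_eq_det] at hz
  set M := LinearMap.toMatrix (Module.finBasis ℂ V) (Module.finBasis ℂ V) f
  have hM : M ^ m = 1 := by
    rw [LinearMap.toMatrix_pow, hf, LinearMap.toMatrix_one]
  -- A kernel vector is fixed by `z • M`, hence by its `m`-th power, which is the scalar `z ^ m`.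
  obtain ⟨v, hv, hv0⟩ := Matrix.exists_mulVec_eq_zero_iff.mpr hz
  have h1 : (z • M).mulVec v = v := by
    rw [Matrix.sub_mulVec, Matrix.one_mulVec, sub_eq_zero] at hv0
    exact hv0.symm
  have h2 (k : ℕ) : ((z • M) ^ k).mulVec v = v := by
    induction k with
    | zero => simp
    | succ k ih => rw [pow_succ, ← Matrix.mulVec_mulVec, h1, ih]
  have h3 := h2 m
  rw [smul_pow, hM, Matrix.smul_mulVec, Matrix.one_mulVec] at h3
  have h4 : (z ^ m - 1) • v = 0 := by rw [sub_smul, h3, one_smul, sub_self]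
  have h5 : z ^ m = 1 := sub_eq_zero.mp ((smul_eq_zero.mp h4).resolve_right hv)
  exact Complex.norm_eq_one_of_pow_eq_one h5 hm

end DetOneSub

/-! ### Holomorphic logarithms of polynomials without roots in the unit disk. -/

section PolynomialLog

open Polynomial

/-- The branch of the logarithm of a polynomial with constant coefficient `1` and no roots in the
open unit disk which is holomorphic on this disk and vanishes at `0`. -/
def polyLog (P : ℂ[X]) (z : ℂ) : ℂ := (P.roots.map fun β => Complex.log (1 - z / β)).sum

/-- `P` has constant coefficient `1` and no roots in the open unit disk. -/
structure IsLocalPoly (P : ℂ[X]) : Prop where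
  eval_zero : P.eval 0 = 1
  one_le_norm : ∀ β ∈ P.roots, 1 ≤ ‖β‖

theorem polyLog_zero (P : ℂ[X]) : polyLog P 0 = 0 := by simp [polyLog]

variable {P : ℂ[X]}

theorem IsLocalPoly.norm_div_lt (hP : IsLocalPoly P) {β z : ℂ} (hβ : β ∈ P.roots)
    (hz : ‖z‖ < 1) : ‖z / β‖ < 1 := by
  have h := hP.one_le_norm β hβ
  rw [norm_div, div_lt_one (by linarith)]
  linarith

theorem one_sub_mem_slitPlane {w : ℂ} (hw : ‖w‖ < 1) : 1 - w ∈ Complex.slitPlane := by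
  have := Complex.mem_slitPlane_of_norm_lt_one (z := -w) (by simpa using hw)
  rwa [← sub_eq_add_neg] at this

theorem IsLocalPoly.differentiableOn_polyLog (hP : IsLocalPoly P) :
    DifferentiableOn ℂ (polyLog P) (Metric.ball 0 1) := by
  intro z hz
  rw [mem_ball_zero_iff] at hz
  have key : ∀ s : Multiset ℂ, (∀ β ∈ s, β ∈ P.roots) →
      DifferentiableAt ℂ (fun z => (s.map fun β => Complex.log (1 - z / β)).sum) z := by
    intro s
    induction s using Multiset.induction_on with
    | empty => intro _; simp
    | cons a s ih =>
      intro hs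
      simp only [Multiset.map_cons, Multiset.sum_cons]
      refine DifferentiableAt.fun_add ?_ (ih fun β hβ => hs β (Multiset.mem_cons_of_mem hβ))
      refine DifferentiableAt.clog (by fun_prop) (one_sub_mem_slitPlane ?_)
      exact hP.norm_div_lt (hs a (Multiset.mem_cons_self a s)) hz
  exact (key _ fun _ h => h).differentiableWithinAt

theorem IsLocalPoly.exp_polyLog (hP : IsLocalPoly P) {z : ℂ} (hz : ‖z‖ < 1) :
    Complex.exp (polyLog P z) = P.eval z := by
  have hne : P ≠ 0 := by rintro rfl; simpa using hP.eval_zero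
  have hprod := (IsAlgClosed.splits P).eq_prod_roots
  have hev (w : ℂ) : P.eval w = P.leadingCoeff * (P.roots.map fun β => w - β).prod := by
    conv_lhs => rw [hprod]
    rw [eval_mul, eval_C, eval_multiset_prod, Multiset.map_map]
    simp
  -- Here `1 - z / β = (z - β) / (0 - β)`; over all roots the denominators times the leading
  -- coefficient give `P.eval 0 = 1`.
  have key : ∀ s : Multiset ℂ, (∀ β ∈ s, β ∈ P.roots) →
      Complex.exp (s.map fun β => Complex.log (1 - z / β)).sum * (s.map fun β => 0 - β).prod =
        (s.map fun β => z - β).prod := by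
    intro s
    induction s using Multiset.induction_on with
    | empty => intro _; simp
    | cons a s ih =>
      intro hs
      have ha := hs a (Multiset.mem_cons_self a s)
      have ha0 : a ≠ 0 := by
        rintro rfl; simpa using (zero_lt_one.trans_le (hP.one_le_norm 0 ha))
      simp only [Multiset.map_cons, Multiset.sum_cons, Multiset.prod_cons]
      rw [Complex.exp_add, Complex.exp_log
        (Complex.slitPlane_ne_zero (one_sub_mem_slitPlane (hP.norm_div_lt ha hz))),
        ← ih fun β hβ => hs β (Multiset.mem_cons_of_mem hβ)]
      field_simp
      ring
  rw [hev, ← key _ fun _ h => h]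
  have h0 := hev 0
  rw [hP.eval_zero] at h0
  rw [mul_left_comm, ← h0, mul_one, polyLog]

theorem IsLocalPoly.norm_polyLog_le (hP : IsLocalPoly P) {z : ℂ} (hz : ‖z‖ ≤ 1 / 2) :
    ‖polyLog P z‖ ≤ P.natDegree * (3 / 2 * ‖z‖) := by
  have key : ∀ s : Multiset ℂ, (∀ β ∈ s, β ∈ P.roots) →
      ‖(s.map fun β => Complex.log (1 - z / β)).sum‖ ≤ s.card * (3 / 2 * ‖z‖) := by
    intro s
    induction s using Multiset.induction_on with
    | empty => intro _; simp
    | cons a s ih =>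
      intro hs
      have ha := hP.one_le_norm a (hs a (Multiset.mem_cons_self a s))
      simp only [Multiset.map_cons, Multiset.sum_cons, Multiset.card_cons]
      have h1 : ‖-(z / a)‖ ≤ ‖z‖ := by
        rw [norm_neg, norm_div]; exact div_le_self (norm_nonneg z) ha
      have h2 := Complex.norm_log_one_add_half_le_self (h1.trans hz)
      rw [← sub_eq_add_neg] at h2
      have h3 := ih fun β hβ => hs β (Multiset.mem_cons_of_mem hβ)
      refine (norm_add_le _ _).trans ?_
      push_cast
      nlinarith
  refine (key _ fun _ h => h).trans ?_
  have := P.card_roots'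
  gcongr

/-- The Taylor series of `polyLog P (z ^ n)`. -/
theorem IsLocalPoly.taylorSeries_polyLog (hP : IsLocalPoly P) {n : ℕ} (hn : n ≠ 0) :
    taylorSeries (fun z => polyLog P (z ^ n)) =
      PowerSeries.logOf ((P.comp (X ^ n) : ℂ[X]) : PowerSeries ℂ) := by
  rw [← taylorSeries_eval]
  have hball : ∀ᶠ z : ℂ in nhds 0, ‖z ^ n‖ < 1 := by
    have : Filter.Tendsto (fun z : ℂ => ‖z ^ n‖) (nhds 0) (nhds ‖(0 : ℂ) ^ n‖) :=
      (by fun_prop : Continuous fun z : ℂ => ‖z ^ n‖).tendsto 0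
    refine this.eventually_lt_const ?_
    simp [hn]
  refine (logOf_taylorSeries ?_ (by simp [hn, polyLog_zero]) ?_).symm
  · exact AnalyticAt.comp_of_eq (g := polyLog P) (f := fun z => z ^ n)
      (hP.differentiableOn_polyLog.analyticAt (Metric.ball_mem_nhds 0 one_pos)) (by fun_prop)
      (zero_pow hn)
  · filter_upwards [hball] with z hz
    rw [hP.exp_polyLog hz]; simp

end PolynomialLog

/-! ### Leading terms of formal logarithms. -/

section FormalLog

open PowerSeries

/-- In `(log f)' * f = f'` the factor `f` is `1` modulo `X ^ n`, so the two derivatives agree below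
degree `n`. -/
theorem coeff_logOf_eq {f g : ℂ⟦X⟧} {n : ℕ} (hn : n ≠ 0) (hf : f = 1 + X ^ n * g) {k : ℕ}
    (hk : k ≤ n) : coeff k (logOf f) = coeff k (f - 1) := by
  have hc : constantCoeff f = 1 := by rw [hf]; simp [hn]
  rcases k with _ | k
  · simp [constantCoeff_logOf hc, hc]
  have h1 := derivative_logOf_mul hc
  have h1' : d⁄dX ℂ (logOf f) + X ^ n * (d⁄dX ℂ (logOf f) * g) = d⁄dX ℂ f := by
    rw [← h1]
    generalize d⁄dX ℂ (logOf f) = D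
    rw [hf]; ring
  have h2 := congrArg (coeff k) h1'
  rw [map_add, coeff_X_pow_mul', if_neg (by omega), add_zero, coeff_derivative,
    coeff_derivative] at h2
  have h3 : ((k : ℂ) + 1) ≠ 0 := by exact_mod_cast k.succ_ne_zero
  rw [map_sub, coeff_one, if_neg k.succ_ne_zero, sub_zero]
  exact mul_right_cancel₀ h3 h2

theorem coeff_logOf_comp_X_pow {P : Polynomial ℂ} (hP : P.eval 0 = 1) {n : ℕ} (hn : n ≠ 0)
    {k : ℕ} (hk : k ≤ n) :
    coeff k (logOf ((P.comp (Polynomial.X ^ n) : Polynomial ℂ) : ℂ⟦X⟧)) =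
      if k = n then P.coeff 1 else 0 := by
  have hdiv : P = 1 + Polynomial.X * P.divX := by
    conv_lhs => rw [← P.X_mul_divX_add]
    rw [Polynomial.coeff_zero_eq_eval_zero, hP, map_one, add_comm]
  have hcomp : ((P.comp (Polynomial.X ^ n) : Polynomial ℂ) : ℂ⟦X⟧) =
      1 + X ^ n * ((P.divX.comp (Polynomial.X ^ n) : Polynomial ℂ) : ℂ⟦X⟧) := by
    conv_lhs => rw [hdiv]
    simp
  rw [coeff_logOf_eq hn hcomp hk, hcomp, add_sub_cancel_left, coeff_X_pow_mul']
  rcases hk.lt_or_eq with h | rfl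
  · rw [if_neg (by omega), if_neg (by omega)]
  · rw [if_pos le_rfl, if_pos rfl, Nat.sub_self, Polynomial.coeff_coe,
      Polynomial.coeff_zero_eq_eval_zero, Polynomial.eval_comp]
    simp [hn, ← Polynomial.coeff_zero_eq_eval_zero]

end FormalLog

/-! ### Recursive construction of the coefficients, and part (i). -/

section LogDecomposition

open PowerSeries

/-- A fixed degree receives contributions from finitely many `n` only, so coefficientwise
convergence is a matter of finite support. -/
theorem hasSum_pnat_prod {ι : Type*} [Fintype ι] {F : ℕ → ι → ℂ} {N : ℕ}
    (hF : ∀ n, N < n → ∀ i, F n i = 0) :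
    HasSum (fun i : ℕ+ × ι => F i.1 i.2) (∑ n ∈ Finset.Icc 1 N, ∑ i, F n i) := by
  let s : Finset ℕ+ := (Finset.range N).map ⟨Nat.succPNat, Nat.succPNat_injective⟩
  have hs (n : ℕ+) (hn : (n : ℕ) ≤ N) : n ∈ s :=
    Finset.mem_map.mpr ⟨n.natPred, Finset.mem_range.mpr
      (by have := n.natPred_add_one; omega), n.succPNat_natPred⟩
  have h := hasSum_sum_of_ne_finset_zero (f := fun i : ℕ+ × ι => F i.1 i.2)
    (L := .unconditional _) (s := s ×ˢ Finset.univ) (by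
      rintro ⟨n, i⟩ hn
      refine hF _ ?_ _
      by_contra hle
      exact hn (Finset.mem_product.mpr ⟨hs n (not_lt.mp hle), Finset.mem_univ i⟩))
  have heq : ∑ n ∈ Finset.Icc 1 N, ∑ i, F n i = ∑ x ∈ s ×ˢ Finset.univ, F x.1 x.2 := by
    rw [Finset.sum_product, Finset.sum_map]
    refine Finset.sum_nbij' (fun n => n - 1) (fun n => n + 1) ?_ ?_ ?_ ?_ ?_
    · intro n hn; have := Finset.mem_Icc.mp hn; exact Finset.mem_range.mpr (by omega)
    · intro n hn; have := Finset.mem_range.mp hn; exact Finset.mem_Icc.mpr (by omega)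
    · intro n hn; have := Finset.mem_Icc.mp hn; omega
    · intro n _; omega
    · intro n hn
      have := Finset.mem_Icc.mp hn
      have h1 : ((Nat.succPNat (n - 1) : ℕ+) : ℕ) = n := by rw [Nat.succPNat_coe]; omega
      change _ = ∑ i, F ((Nat.succPNat (n - 1) : ℕ+) : ℕ) i
      rw [h1]
  rw [heq]
  exact h

variable {G : Type*} [Group G]

theorem detOneSub_conj_rep {V : Type*} [AddCommGroup V] [Module ℂ V] [FiniteDimensional ℂ V]
    (ρ : Representation ℂ G V) (g h : G) : detOneSub (ρ (h * g * h⁻¹)) = detOneSub (ρ g) := by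
  let e : V ≃ₗ[ℂ] V := LinearEquiv.ofLinearMap (ρ h) (ρ h⁻¹)
    (by rw [← Module.End.mul_eq_comp, ← map_mul]; simp; rfl)
    (by rw [← Module.End.mul_eq_comp, ← map_mul]; simp; rfl)
  rw [← detOneSub_conj e (ρ g)]
  congr 1
  rw [map_mul, map_mul]
  rfl

/-- The formal power series `log det (I - χ(g) z ^ n)`. -/
def logDetSeries (n : ℕ) (χ : IrrChar G) (g : G) : ℂ⟦X⟧ :=
  logOf (((detOneSub (χ.rep g)).comp (Polynomial.X ^ n) : Polynomial ℂ) : ℂ⟦X⟧)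

theorem logDetSeries_conj (n : ℕ) (χ : IrrChar G) (g h : G) :
    logDetSeries n χ (h * g * h⁻¹) = logDetSeries n χ g := by
  rw [logDetSeries, detOneSub_conj_rep, logDetSeries]

theorem coeff_logDetSeries {n : ℕ} (hn : n ≠ 0) {k : ℕ} (hk : k ≤ n) (χ : IrrChar G) (g : G) :
    coeff k (logDetSeries n χ g) = if k = n then -χ.1 g else 0 := by
  rw [logDetSeries, coeff_logOf_comp_X_pow (eval_zero_detOneSub _) hn hk, coeff_one_detOneSub]
  conv_rhs => rw [← χ.rep_character]
  rfl

variable [Finite G]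

open Classical in
/-- Coefficients of a class function with respect to the irreducible characters. -/
def classCoeff (f : G → ℂ) : IrrChar G → ℂ :=
  if h : ∃ b : IrrChar G → ℂ, ∀ g, f g = ∑ χ, b χ * χ.1 g then h.choose else 0

theorem sum_classCoeff_mul {f : G → ℂ} (hf : ∀ g h, f (h * g * h⁻¹) = f g) (g : G) :
    ∑ χ, classCoeff f χ * χ.1 g = f g := by
  have h := exists_eq_sum_irrChar hf
  rw [classCoeff, dif_pos h]
  exact (h.choose_spec g).symm

/-- The recursively defined coefficients `b n χ` of a family of power series with
respect to the series `-log det (I - χ(g) z ^ n)`. -/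
def logCoeff (q : G → ℂ⟦X⟧) (k : ℕ) : IrrChar G → ℂ :=
  -- The expansion carries `-b * log det`, so the terms with `n < k` change sign when moved to the
  -- side of `q g`. `attach` retains the bound needed for termination.
  classCoeff fun g => coeff k (q g) + ∑ n ∈ (Finset.Ico 1 k).attach,
    ∑ χ, logCoeff q n.1 χ * coeff k (logDetSeries n.1 χ g)
termination_by k
decreasing_by exact (Finset.mem_Ico.mp n.2).2

theorem hasSum_logCoeff {q : G → ℂ⟦X⟧} (hq : ∀ g h, q (h * g * h⁻¹) = q g)
    (hq0 : ∀ g, constantCoeff (q g) = 0) (g : G) :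
    HasSum (fun i : ℕ+ × IrrChar G => -(logCoeff q i.1 i.2 • logDetSeries i.1 i.2 g)) (q g) := by
  rw [PowerSeries.WithPiTopology.hasSum_iff_hasSum_coeff]
  intro k
  have hvan (n : ℕ) (hn : k < n) (χ : IrrChar G) :
      coeff k (-(logCoeff q n χ • logDetSeries n χ g)) = 0 := by
    rw [map_neg, coeff_smul, coeff_logDetSeries (by omega) hn.le, if_neg hn.ne, smul_zero, neg_zero]
  have h := hasSum_pnat_prod (F := fun n χ => coeff k (-(logCoeff q n χ • logDetSeries n χ g)))
    hvan
  suffices heq : ∑ n ∈ Finset.Icc 1 k, ∑ χ, coeff k (-(logCoeff q n χ • logDetSeries n χ g)) =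
      coeff k (q g) by rwa [heq] at h
  rcases k with _ | k
  · simp [hq0]
  rw [← Finset.Ico_insert_right (by omega), Finset.sum_insert (by simp)]
  have h1 (χ : IrrChar G) : coeff (k + 1) (-(logCoeff q (k + 1) χ • logDetSeries (k + 1) χ g)) =
      logCoeff q (k + 1) χ * χ.1 g := by
    rw [map_neg, coeff_smul, coeff_logDetSeries (by omega) le_rfl, if_pos rfl, smul_eq_mul]; ring
  simp only [h1]
  rw [logCoeff, sum_classCoeff_mul]
  · rw [Finset.sum_attach (Finset.Ico 1 (k + 1))
      (fun n => ∑ χ, logCoeff q n χ * coeff (k + 1) (logDetSeries n χ g))]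
    simp
  · intro g h
    simp only [hq, logDetSeries_conj]

end LogDecomposition

theorem exists_isLogDecomposition (E : Type*) [Field E] [NumberField E] [IsGalois ℚ E]
    (Q : Nat.Primes → ℂ → ℂ) (hfrob : IsFrobenian E Q) (hQ0 : ∀ p, Q p 0 = 1) :
    ∃ b : ℕ → IrrChar Gal(E/ℚ) → ℂ, IsLogDecomposition E Q b := by
  classical
  obtain ⟨T, c, hT, hc, hTc⟩ := hfrob
  let q : Gal(E/ℚ) → PowerSeries ℂ := fun g =>
    -- The value `c g 0` is known only for a Frobenius `g` at a prime outside `T`. The default `0`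
    -- keeps the constant coefficient zero on all of the group.
    if c g 0 = 1 then PowerSeries.logOf (taylorSeries (c g)) else 0
  refine ⟨logCoeff q, ?_⟩
  filter_upwards [hT.compl_mem_cofinite] with p hp σ hσ
  have hQc := (hTc p hp).2 σ hσ
  have hc0 : c σ 0 = 1 := by rw [← hQc, hQ0]
  have hq : PowerSeries.logOf (taylorSeries (Q p)) = q σ := by
    simp only [q, if_pos hc0, hQc]
  rw [hq]
  refine hasSum_logCoeff (fun g h => by simp only [q, hc]) (fun g => ?_) σ
  simp only [q]
  split_ifs with h
  · exact PowerSeries.constantCoeff_logOf (by rw [constantCoeff_taylorSeries, h])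
  · simp

/-! ### Size of `p ^ (-s)`. -/

section PrimePowers

theorem norm_prime_cpow (p : Nat.Primes) (s : ℂ) : ‖(p : ℂ) ^ (-s)‖ = (p : ℝ) ^ (-s.re) := by
  rw [Complex.norm_natCast_cpow_of_pos p.2.pos, Complex.neg_re]

theorem one_lt_prime (p : Nat.Primes) : (1 : ℝ) < (p : ℕ) := by exact_mod_cast p.2.one_lt

theorem prime_rpow_neg_le_half (p : Nat.Primes) {x : ℝ} (hx : 1 ≤ x) :
    (p : ℝ) ^ (-x) ≤ 1 / 2 := by
  calc (p : ℝ) ^ (-x) ≤ (p : ℝ) ^ (-1 : ℝ) :=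
        Real.rpow_le_rpow_of_exponent_le (one_lt_prime p).le (by linarith)
    _ = 1 / (p : ℝ) := by rw [Real.rpow_neg_one, one_div]
    _ ≤ 1 / 2 := by
        have : (2 : ℝ) ≤ (p : ℕ) := by exact_mod_cast p.2.two_le
        gcongr

theorem prime_rpow_neg_lt_one (p : Nat.Primes) {x : ℝ} (hx : 0 < x) : (p : ℝ) ^ (-x) < 1 :=
  Real.rpow_lt_one_of_one_lt_of_neg (one_lt_prime p) (by linarith)

theorem summable_prime_rpow_neg {x : ℝ} (hx : 1 < x) :
    Summable fun p : Nat.Primes => (p : ℝ) ^ (-x) :=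
  Nat.Primes.summable_rpow.mpr (by linarith)

end PrimePowers

/-! ### The standard logarithm of an Artin `L`-function. -/

section ArtinLog

variable {E : Type*} [Field E] [NumberField E]

theorem isLocalPoly_detOneSub {V : Type*} [AddCommGroup V] [Module ℂ V] [FiniteDimensional ℂ V]
    {f : V →ₗ[ℂ] V} {m : ℕ} (hm : m ≠ 0) (hf : f ^ m = 1) : IsLocalPoly (detOneSub f) where
  eval_zero := eval_zero_detOneSub f
  one_le_norm _ hβ :=
    (norm_eq_one_of_isRoot_detOneSub hm hf (Polynomial.isRoot_of_mem_roots hβ)).ge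

/-- If `g` is in the inertia group then `g * σ` is a second Frobenius at `𝔓`; at an unramified prime
it must equal `σ`, and the Galois action is faithful. -/
theorem eq_one_of_mem_inertia [IsGalois ℚ E] {p : Nat.Primes} {𝔓 : Ideal (𝓞 E)}
    (hp : Algebra.IsUnramifiedIn (𝓞 E) (Ideal.span {((p : ℕ) : ℤ)})) (h𝔓 : IsPrimeAbove E p 𝔓)
    {σ : Gal(E/ℚ)} (hσ : IsArithFrobAt ℤ σ 𝔓) {g : Gal(E/ℚ)} (hg : g ∈ 𝔓.inertia Gal(E/ℚ)) :
    g = 1 := by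
  have := h𝔓.1
  have hgσ : IsArithFrobAt ℤ (g * σ) 𝔓 := fun x => by
    have h := add_mem (hg (σ • x)) (hσ x)
    simpa [mul_smul] using h
  have : Algebra.IsUnramifiedAt ℤ 𝔓 := hp 𝔓 h𝔓.1 h𝔓.2
  have h := hgσ.eq_of_isUnramifiedAt hσ (Ideal.primeCompl_le_nonZeroDivisors 𝔓)
  have := (inferInstance : IsGaloisGroup Gal(E/ℚ) ℤ (𝓞 E)).faithful
  have h2 : g * σ = σ := by
    refine FaithfulSMul.eq_of_smul_eq_smul (α := 𝓞 E) fun x => ?_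
    exact DFunLike.congr_fun h x
  exact mul_eq_right.mp h2

variable [IsGalois ℚ E] {V : Type*} [AddCommGroup V] [Module ℂ V] [FiniteDimensional ℂ V]
  (ρ : Representation ℂ Gal(E/ℚ) V)

theorem isLocalPoly_artinPoly (p : Nat.Primes) : IsLocalPoly (artinPoly ρ p) := by
  refine isLocalPoly_detOneSub (m := Nat.card Gal(E/ℚ)) Nat.card_pos.ne' ?_
  rw [Module.End.pow_restrict]
  ext v
  have h : ρ (frobAbove E p) ^ Nat.card Gal(E/ℚ) = 1 := by
    rw [← map_pow, pow_card_eq_one', map_one]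
  simp only [h]
  rfl

theorem natDegree_artinPoly_le (p : Nat.Primes) :
    (artinPoly ρ p).natDegree ≤ Module.finrank ℂ V :=
  (natDegree_detOneSub_le _).trans (Submodule.finrank_le _)

theorem artinPoly_eq_of_isUnramifiedIn {p : Nat.Primes}
    (hp : Algebra.IsUnramifiedIn (𝓞 E) (Ideal.span {((p : ℕ) : ℤ)})) :
    artinPoly ρ p = detOneSub (ρ (frobAbove E p)) := by
  have htop : inertiaInvariants ρ p = ⊤ := by
    refine eq_top_iff.mpr fun v _ g hg => ?_
    rw [eq_one_of_mem_inertia hp (primeAbove_spec E p) (frobAbove_spec E p) hg]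
    simp
  rw [artinPoly, ← detOneSub_conj (LinearEquiv.ofTop _ htop)]
  congr 1

/-- The local summand of `-log L(s, ρ)` at `p`. -/
def artinLocalLog (p : Nat.Primes) (s : ℂ) : ℂ := polyLog (artinPoly ρ p) ((p : ℂ) ^ (-s))

/-- The degree is at most the dimension of `V`, ramified primes included. The bound is uniform on a
half-plane, as the Weierstrass test and dominated convergence require. -/
theorem norm_artinLocalLog_le (p : Nat.Primes) {s : ℂ} {x : ℝ} (hx : 1 ≤ x) (hs : x ≤ s.re) :
    ‖artinLocalLog ρ p s‖ ≤ Module.finrank ℂ V * (3 / 2 * (p : ℝ) ^ (-x)) := by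
  have h := (isLocalPoly_artinPoly ρ p).norm_polyLog_le (z := (p : ℂ) ^ (-s))
    (by rw [norm_prime_cpow]; exact prime_rpow_neg_le_half p (hx.trans hs))
  refine h.trans ?_
  rw [norm_prime_cpow]
  have h1 := natDegree_artinPoly_le ρ p
  have h2 : (p : ℝ) ^ (-s.re) ≤ (p : ℝ) ^ (-x) :=
    Real.rpow_le_rpow_of_exponent_le (one_lt_prime p).le (by linarith)
  gcongr

theorem summable_artinLocalLog {s : ℂ} (hs : 1 < s.re) :
    Summable fun p => artinLocalLog ρ p s :=
  Summable.of_norm_bounded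
    (((summable_prime_rpow_neg hs).mul_left _).mul_left _)
    fun p => norm_artinLocalLog_le ρ p hs.le le_rfl

theorem exp_artinLocalLog (p : Nat.Primes) {s : ℂ} (hs : 0 < s.re) :
    Complex.exp (artinLocalLog ρ p s) = (artinPoly ρ p).eval ((p : ℂ) ^ (-s)) :=
  (isLocalPoly_artinPoly ρ p).exp_polyLog
    (by rw [norm_prime_cpow]; exact prime_rpow_neg_lt_one p hs)

/-- The standard branch of `log L(s, ρ)` on `Re s > 1`. -/
def logArtinL (s : ℂ) : ℂ := -∑' p, artinLocalLog ρ p s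

theorem hasProd_artinFactor {s : ℂ} (hs : 1 < s.re) :
    HasProd (fun p => artinFactor ρ p s) (Complex.exp (logArtinL ρ s)) := by
  have h := (summable_artinLocalLog ρ hs).hasSum.neg.cexp
  have heq : (fun p => artinFactor ρ p s) = Complex.exp ∘ fun p => -artinLocalLog ρ p s := by
    funext p
    rw [Function.comp_apply, Complex.exp_neg, exp_artinLocalLog ρ p (by linarith), artinFactor]
  rw [heq]
  exact h

theorem isLogArtinL_logArtinL : IsLogArtinL ρ (logArtinL ρ) where
  differentiableOn := by
    refine DifferentiableOn.fun_neg ?_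
    intro s hs
    have hs : 1 < s.re := hs
    -- A summable majorant exists only on half-planes strictly inside `Re s > 1`; differentiability
    -- is local, so one around `s` suffices.
    obtain ⟨x, hx1, hxs⟩ := exists_between hs
    have hopen : IsOpen {w : ℂ | x < w.re} := isOpen_lt continuous_const Complex.continuous_re
    refine ((Complex.differentiableOn_tsum_of_summable_norm
      (((summable_prime_rpow_neg hx1).mul_left (3 / 2)).mul_left (Module.finrank ℂ V : ℝ))
      (fun p => ?_) hopen fun p w hw =>
        norm_artinLocalLog_le ρ p hx1.le (le_of_lt hw)).differentiableAt
        (hopen.mem_nhds hxs)).differentiableWithinAt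
    refine (isLocalPoly_artinPoly ρ p).differentiableOn_polyLog.comp
      (f := fun w : ℂ => (p : ℂ) ^ (-w)) ?_ fun w hw => ?_
    · have hp : ((p : ℕ) : ℂ) ≠ 0 := by exact_mod_cast p.2.ne_zero
      exact (differentiable_neg.const_cpow (Or.inl hp)).differentiableOn
    · have hw : x < w.re := hw
      rw [mem_ball_zero_iff, norm_prime_cpow]
      exact prime_rpow_neg_lt_one p (by linarith)
  multipliable s hs := (hasProd_artinFactor ρ hs).multipliable
  exp_eq s hs := (hasProd_artinFactor ρ hs).tprod_eq.symm
  tendsto := by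
    have h := tendsto_tsum_of_dominated_convergence
      (f := fun (x : ℝ) p => artinLocalLog ρ p (x : ℂ)) (g := fun _ : Nat.Primes => (0 : ℂ))
      (𝓕 := Filter.atTop)
      (((summable_prime_rpow_neg one_lt_two).mul_left (3 / 2)).mul_left (Module.finrank ℂ V : ℝ))
      (fun p => ?_) ?_
    · simpa [logArtinL] using h.neg
    · refine squeeze_zero_norm' (a := fun x : ℝ =>
        Module.finrank ℂ V * (3 / 2 * (p : ℝ) ^ (-x))) ?_ ?_
      · filter_upwards [Filter.eventually_ge_atTop 1] with x hx
        exact norm_artinLocalLog_le ρ p hx (by simp)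
      · have h1 : Filter.Tendsto (fun x : ℝ => (p : ℝ) ^ (-x)) Filter.atTop (nhds 0) :=
          (tendsto_rpow_atBot_of_base_gt_one _ (one_lt_prime p)).comp Filter.tendsto_neg_atTop_atBot
        simpa using (h1.const_mul (3 / 2)).const_mul (Module.finrank ℂ V : ℝ)
    · filter_upwards [Filter.eventually_ge_atTop 2] with x hx p
      exact norm_artinLocalLog_le ρ p one_le_two (by simpa using hx)

end ArtinLog

/-! ### From absolutely convergent Euler products to Dirichlet series. -/

section EulerProduct

/-- A function which is multiplicative on coprime arguments is absolutely summable if its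
Euler product converges absolutely. -/
theorem summable_norm_of_multiplicative {f : ℕ → ℂ} (hf0 : f 0 = 0) (hf1 : f 1 = 1)
    (hmul : ∀ {m n : ℕ}, m.Coprime n → f (m * n) = f m * f n)
    (hloc : ∀ {p : ℕ}, p.Prime → Summable fun k => ‖f (p ^ k)‖)
    (hsum : Summable fun p : Nat.Primes => ∑' k, ‖f ((p : ℕ) ^ (k + 1))‖) :
    Summable fun n => ‖f n‖ := by
  obtain ⟨g, hg⟩ : ∃ g : ℕ → ℝ, ∀ n, g n = ‖f n‖ := ⟨_, fun _ => rfl⟩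
  have hg0 (n : ℕ) : 0 ≤ g n := by rw [hg]; exact norm_nonneg _
  simp only [← hg] at hloc hsum ⊢
  obtain ⟨u, hu⟩ : ∃ u : Nat.Primes → ℝ, ∀ p, u p = ∑' k, g ((p : ℕ) ^ (k + 1)) :=
    ⟨_, fun _ => rfl⟩
  simp only [← hu] at hsum
  have hu0 (p : Nat.Primes) : 0 ≤ u p := by rw [hu]; exact tsum_nonneg fun _ => hg0 _
  have hg1 : g 1 = 1 := by rw [hg, hf1, norm_one]
  have hgmul {m n : ℕ} (h : m.Coprime n) : g (m * n) = g m * g n := by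
    simp only [hg, hmul h, norm_mul]
  have hgloc {p : ℕ} (hp : p.Prime) : Summable fun k => ‖g (p ^ k)‖ := (hloc hp).norm
  have hsm (N : ℕ) := (EulerProduct.summable_and_hasSum_smoothNumbers_prod_primesBelow_tsum
    hg1 hgmul hgloc N).2
  -- From `1 + u ≤ exp u`, all finite Euler products share one bound.
  have hle (N : ℕ) : ∏ p ∈ N.primesBelow, ∑' k, g (p ^ k) ≤ Real.exp (∑' p, u p) := by
    have hp (p : {p // p ∈ N.primesBelow}) : p.1.Prime := Nat.prime_of_mem_primesBelow p.2
    rw [← Finset.prod_attach]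
    let emb : {p // p ∈ N.primesBelow} ↪ Nat.Primes :=
      ⟨fun p => ⟨p.1, hp p⟩, fun p q h => Subtype.ext (congrArg (fun x : Nat.Primes => x.1) h)⟩
    have hfac (p : {p // p ∈ N.primesBelow}) : ∑' k, g (p.1 ^ k) = 1 + u (emb p) := by
      rw [(hloc (hp p)).tsum_eq_zero_add, pow_zero, hg1, hu]
      rfl
    calc ∏ p ∈ N.primesBelow.attach, ∑' k, g (p.1 ^ k)
        ≤ ∏ p ∈ N.primesBelow.attach, Real.exp (u (emb p)) := by
          refine Finset.prod_le_prod (fun p _ => tsum_nonneg fun _ => hg0 _) fun p _ => ?_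
          rw [hfac, add_comm]
          exact Real.add_one_le_exp _
      _ = Real.exp (∑ p ∈ N.primesBelow.attach.map emb, u p) := by
          rw [Finset.sum_map, Real.exp_sum]
      _ ≤ Real.exp (∑' p, u p) :=
          Real.exp_le_exp.mpr (hsum.sum_le_tsum _ fun p _ => hu0 p)
  refine summable_of_sum_le (c := Real.exp (∑' p, u p)) hg0 fun t => ?_
  obtain ⟨N, hN⟩ : ∃ N, ∀ m ∈ t, m < N :=
    ⟨t.sup id + 1, fun m hm => Nat.lt_succ_of_le (Finset.le_sup (f := id) hm)⟩
  refine le_trans ?_ (hle N)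
  -- Every nonzero `m < N` is `N`-smooth, so a finite partial sum is dominated by the Euler product
  -- over primes below `N`.
  have hind := hasSum_subtype_iff_indicator.mp (hsm N)
  refine le_trans (Finset.sum_le_sum fun m hm => ?_)
    (sum_le_hasSum t (fun m _ => Set.indicator_nonneg (fun _ _ => hg0 _) m) hind)
  rcases eq_or_ne m 0 with rfl | h0
  · rw [hg, hf0, norm_zero]
    exact Set.indicator_nonneg (fun _ _ => hg0 _) _
  · rw [Set.indicator_of_mem (Nat.mem_smoothNumbers_of_lt (Nat.pos_of_ne_zero h0) (hN m hm))]

/-- The coefficients of the Dirichlet series with Euler product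
`∏ p, ∑ k, φ p k * p ^ (-k * s)`. -/
def eulerCoeff (φ : ℕ → ℕ → ℂ) (m : ℕ) : ℂ := m.factorization.prod φ

variable {φ : ℕ → ℕ → ℂ}

theorem eulerCoeff_mul {m n : ℕ} (h : m.Coprime n) :
    eulerCoeff φ (m * n) = eulerCoeff φ m * eulerCoeff φ n := by
  rw [eulerCoeff, Nat.factorization_mul_of_coprime h,
    Finsupp.prod_add_index_of_disjoint h.disjoint_primeFactors]
  rfl

theorem eulerCoeff_prime_pow (hφ : ∀ p, φ p 0 = 1) {p : ℕ} (hp : p.Prime) (k : ℕ) :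
    eulerCoeff φ (p ^ k) = φ p k := by
  rw [eulerCoeff, hp.factorization_pow, Finsupp.prod_single_index (hφ p)]

theorem term_eulerCoeff_prime_pow (hφ : ∀ p, φ p 0 = 1) {p : ℕ} (hp : p.Prime) (k : ℕ) (s : ℂ) :
    LSeries.term (eulerCoeff φ) s (p ^ k) = φ p k * ((p : ℂ) ^ (-s)) ^ k := by
  rw [LSeries.term_of_ne_zero (pow_ne_zero k hp.ne_zero), eulerCoeff_prime_pow hφ hp,
    Complex.cpow_neg, inv_pow, Nat.cast_pow, ← Complex.natCast_cpow_natCast_mul,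
    div_eq_mul_inv, Complex.cpow_nat_mul]

theorem lseries_eulerCoeff (hφ : ∀ p, φ p 0 = 1) {s : ℂ}
    (hloc : ∀ p : Nat.Primes, Summable fun k => ‖φ p k‖ * ((p : ℝ) ^ (-s.re)) ^ k)
    (hsum : Summable fun p : Nat.Primes => ∑' k, ‖φ p (k + 1)‖ * ((p : ℝ) ^ (-s.re)) ^ (k + 1)) :
    LSeriesSummable (eulerCoeff φ) s ∧
      HasProd (fun p : Nat.Primes => ∑' k, φ p k * ((p : ℂ) ^ (-s)) ^ k)
        (LSeries (eulerCoeff φ) s) := by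
  set f := LSeries.term (eulerCoeff φ) s
  have hf0 : f 0 = 0 := LSeries.term_zero _ _
  have hf1 : f 1 = 1 := by simp [f, LSeries.term_of_ne_zero, eulerCoeff]
  have hmul {m n : ℕ} (h : m.Coprime n) : f (m * n) = f m * f n := by
    rcases eq_or_ne m 0 with rfl | hm
    · simp [hf0]
    rcases eq_or_ne n 0 with rfl | hn
    · simp [hf0]
    simp only [f]
    rw [LSeries.term_of_ne_zero (mul_ne_zero hm hn), LSeries.term_of_ne_zero hm,
      LSeries.term_of_ne_zero hn, eulerCoeff_mul h, Nat.cast_mul,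
      Complex.natCast_mul_natCast_cpow, div_mul_div_comm]
  have hnorm (p : Nat.Primes) (k : ℕ) :
      ‖f ((p : ℕ) ^ k)‖ = ‖φ p k‖ * ((p : ℝ) ^ (-s.re)) ^ k := by
    simp only [f]
    rw [term_eulerCoeff_prime_pow hφ p.2, norm_mul, norm_pow, norm_prime_cpow]
  have hS : Summable fun n => ‖f n‖ := by
    refine summable_norm_of_multiplicative hf0 hf1 hmul (fun {p} hp => ?_) ?_
    · exact (hloc ⟨p, hp⟩).congr fun k => (hnorm ⟨p, hp⟩ k).symm
    · simpa only [← hnorm] using hsum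
  refine ⟨hS.of_norm, ?_⟩
  have h := EulerProduct.eulerProduct_hasProd hf1 hmul hS hf0
  have heq : (fun p : Nat.Primes => ∑' k, φ p k * ((p : ℂ) ^ (-s)) ^ k) =
      fun p : Nat.Primes => ∑' k, f ((p : ℕ) ^ k) := by
    funext p
    refine tsum_congr fun k => ?_
    simp only [f]
    rw [term_eulerCoeff_prime_pow hφ p.2]
  rw [heq]
  exact h

end EulerProduct

/-! ### Taylor tails of the local factors. -/

section LocalFactor

open PowerSeries Metric

theorem hasSum_coeff_taylorSeries {F : ℂ → ℂ} {R : ℝ} (hF : DifferentiableOn ℂ F (ball 0 R))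
    {z : ℂ} (hz : ‖z‖ < R) : HasSum (fun k => coeff k (taylorSeries F) * z ^ k) (F z) := by
  have h := Complex.hasSum_taylorSeries_on_ball hF (z := z) (by simpa using hz)
  refine h.congr_fun fun k => ?_
  rw [coeff_taylorSeries, sub_zero, smul_eq_mul, smul_eq_mul]
  ring

theorem summable_norm_coeff_taylorSeries {F : ℂ → ℂ} {R : ℝ}
    (hF : DifferentiableOn ℂ F (ball 0 R)) {x : ℝ} (hx0 : 0 ≤ x) (hx : x < R) :
    Summable fun k => ‖coeff k (taylorSeries F)‖ * x ^ k := by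
  have h := (hasSum_coeff_taylorSeries hF (z := (x : ℂ))
    (by rwa [Complex.norm_of_nonneg hx0])).summable.norm
  refine h.congr fun k => ?_
  rw [norm_mul, norm_pow, Complex.norm_of_nonneg hx0]

/-- The tail `∑ k ≥ 1, ‖c k‖ * x ^ k` of the majorant of the Taylor series of `F`. -/
def taylorTail (F : ℂ → ℂ) (x : ℝ) : ℝ :=
  ∑' k, ‖coeff (k + 1) (taylorSeries F)‖ * x ^ (k + 1)

theorem taylorTail_nonneg (F : ℂ → ℂ) {x : ℝ} (hx : 0 ≤ x) : 0 ≤ taylorTail F x :=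
  tsum_nonneg fun _ => by positivity

theorem norm_sub_le_taylorTail {F : ℂ → ℂ} {R : ℝ} (hF : DifferentiableOn ℂ F (ball 0 R))
    {z : ℂ} (hz : ‖z‖ < R) : ‖F z - F 0‖ ≤ taylorTail F ‖z‖ := by
  have h := hasSum_coeff_taylorSeries hF hz
  have hs := summable_norm_coeff_taylorSeries hF (norm_nonneg z) hz
  have h0 : coeff 0 (taylorSeries F) * z ^ 0 = F 0 := by
    rw [pow_zero, mul_one, coeff_zero_eq_constantCoeff_apply, constantCoeff_taylorSeries]
  have h1 : F z - F 0 = ∑' k, coeff (k + 1) (taylorSeries F) * z ^ (k + 1) := by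
    rw [← h.tsum_eq, h.summable.tsum_eq_zero_add, h0, add_sub_cancel_left]
  rw [h1]
  refine (norm_tsum_le_tsum_norm ?_).trans_eq ?_
  · simpa only [norm_mul, norm_pow] using (summable_nat_add_iff 1).mpr hs
  · simp only [norm_mul, norm_pow, taylorTail]

/-- Surviving terms have exponent at least `N + 1`; since `x / ρ ≤ 1`, the tail at `x` is at most
`(x / ρ) ^ (N + 1)` times the tail at `ρ`. -/
theorem exists_taylorTail_le {F : ℂ → ℂ} {R ρ : ℝ} (hF : DifferentiableOn ℂ F (ball 0 R))
    (hρ0 : 0 < ρ) (hρ : ρ < R) {N : ℕ}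
    (hN : ∀ k, 1 ≤ k → k ≤ N → coeff k (taylorSeries F) = 0) :
    ∃ M, 0 ≤ M ∧ ∀ x, 0 ≤ x → x ≤ ρ → taylorTail F x ≤ M * x ^ (N + 1) := by
  have hs (x : ℝ) (hx0 : 0 ≤ x) (hx : x ≤ ρ) := (summable_nat_add_iff 1).mpr
    (summable_norm_coeff_taylorSeries hF hx0 (hx.trans_lt hρ))
  refine ⟨taylorTail F ρ / ρ ^ (N + 1),
    div_nonneg (taylorTail_nonneg F hρ0.le) (by positivity), fun x hx0 hx => ?_⟩
  rw [taylorTail, taylorTail, div_mul_eq_mul_div, mul_div_assoc, ← tsum_mul_right]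
  refine (hs x hx0 hx).tsum_le_tsum (fun k => ?_) ((hs ρ hρ0.le le_rfl).mul_right _)
  rcases Nat.lt_or_ge N (k + 1) with hk | hk
  · have h1 : (x / ρ) ^ (k + 1) ≤ (x / ρ) ^ (N + 1) :=
      pow_le_pow_of_le_one (div_nonneg hx0 hρ0.le) ((div_le_one hρ0).mpr hx) (by omega)
    rw [mul_assoc, ← div_pow]
    refine mul_le_mul_of_nonneg_left ?_ (norm_nonneg _)
    calc x ^ (k + 1) = ρ ^ (k + 1) * (x / ρ) ^ (k + 1) := by
          rw [← mul_pow, mul_div_cancel₀ _ hρ0.ne']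
      _ ≤ _ := mul_le_mul_of_nonneg_left h1 (by positivity)
  · rw [hN (k + 1) (by omega) hk]; simp

/-- If almost all members of a family of functions indexed by the primes belong to a finite
set of functions that are `1 + O(z ^ (N + 1))`, then the tails of their Taylor series are summable
at `p ^ (-x)` for `x * (N + 1) > 1`. -/
theorem summable_taylorTail {G : Type*} [Finite G] {F : Nat.Primes → ℂ → ℂ} {A : Set Nat.Primes}
    (hA : A.Finite) (γ : Nat.Primes → G) (Φ : G → ℂ → ℂ) (hFΦ : ∀ p ∉ A, F p = Φ (γ p))
    {r : ℝ} (hr : 0 < r) (hF : ∀ p ∉ A, DifferentiableOn ℂ (F p) (ball 0 r)) {N : ℕ}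
    (hN : ∀ p ∉ A, ∀ k, 1 ≤ k → k ≤ N → coeff k (taylorSeries (F p)) = 0)
    {x : ℝ} (hx : 1 < x * (N + 1)) :
    Summable fun p : Nat.Primes => taylorTail (F p) ((p : ℝ) ^ (-x)) := by
  have := Fintype.ofFinite G
  -- Off `A` the function depends on `γ p` alone, so one prime for each attained `g` supplies the
  -- constant; an unattained `g` needs none.
  have hM (g : G) : ∃ M, 0 ≤ M ∧ ∀ p ∉ A, γ p = g → ∀ y, 0 ≤ y → y ≤ r / 2 →
      taylorTail (F p) y ≤ M * y ^ (N + 1) := by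
    by_cases hg : ∃ p ∉ A, γ p = g
    · obtain ⟨p, hp, hpg⟩ := hg
      obtain ⟨M, hM0, hM⟩ := exists_taylorTail_le (hF p hp) (half_pos hr) (half_lt_self hr) (hN p hp)
      refine ⟨M, hM0, fun p' hp' hpg' => ?_⟩
      rwa [hFΦ p' hp', hpg', ← hpg, ← hFΦ p hp]
    · exact ⟨0, le_rfl, fun p hp hpg => absurd ⟨p, hp, hpg⟩ hg⟩
  choose M hM0 hM using hM
  have hpow (p : Nat.Primes) : ((p : ℝ) ^ (-x)) ^ (N + 1) = (p : ℝ) ^ (-(x * (N + 1))) := by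
    rw [← Real.rpow_natCast, ← Real.rpow_mul (by positivity)]
    push_cast
    ring_nf
  have hsum := summable_prime_rpow_neg hx
  refine Summable.of_norm_bounded_eventually (hsum.mul_left (∑ g, M g)) ?_
  have hsmall : ∀ᶠ p : Nat.Primes in Filter.cofinite, (p : ℝ) ^ (-x) < r / 2 := by
    filter_upwards [hsum.tendsto_cofinite_zero.eventually_lt_const
      (show (0 : ℝ) < (r / 2) ^ (N + 1) by positivity)] with p hp
    rw [← hpow] at hp
    exact lt_of_pow_lt_pow_left₀ _ (by positivity) hp
  filter_upwards [hsmall, hA.compl_mem_cofinite] with p hp hpA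
  have hp0 : (0 : ℝ) ≤ (p : ℝ) ^ (-x) := by positivity
  rw [Real.norm_of_nonneg (taylorTail_nonneg _ hp0), ← hpow]
  refine (hM (γ p) p hpA rfl _ hp0 hp.le).trans ?_
  refine mul_le_mul_of_nonneg_right ?_ (by positivity)
  exact Finset.single_le_sum (f := M) (fun g _ => hM0 g) (Finset.mem_univ _)

variable {I : Type*} [Fintype I]

/-- The finite sum `∑ n ≤ N, ∑ i, b n i * log P i (z ^ n)`. -/
def localExponent (b : ℕ → I → ℂ) (N : ℕ) (P : I → Polynomial ℂ) (z : ℂ) : ℂ :=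
  ∑ n ∈ Finset.Icc 1 N, ∑ i, b n i * polyLog (P i) (z ^ n)

variable {b : ℕ → I → ℂ} {N : ℕ} {P : I → Polynomial ℂ}

theorem differentiableOn_localExponent (hP : ∀ i, IsLocalPoly (P i)) :
    DifferentiableOn ℂ (localExponent b N P) (ball 0 1) := by
  refine DifferentiableOn.fun_sum fun n hn => DifferentiableOn.fun_sum fun i _ => ?_
  refine DifferentiableOn.const_mul ?_ _
  refine (hP i).differentiableOn_polyLog.comp (f := fun z : ℂ => z ^ n) (by fun_prop) ?_
  intro z hz
  rw [mem_ball_zero_iff] at hz ⊢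
  rw [norm_pow]
  exact pow_lt_one₀ (norm_nonneg z) hz (by have := Finset.mem_Icc.mp hn; omega)

theorem localExponent_zero : localExponent b N P 0 = 0 := by
  refine Finset.sum_eq_zero fun n hn => Finset.sum_eq_zero fun i _ => ?_
  rw [zero_pow (by have := Finset.mem_Icc.mp hn; omega), polyLog_zero, mul_zero]

theorem taylorSeries_localExponent (hP : ∀ i, IsLocalPoly (P i)) :
    taylorSeries (localExponent b N P) = ∑ n ∈ Finset.Icc 1 N, ∑ i,
      b n i • logOf (((P i).comp (Polynomial.X ^ n) : Polynomial ℂ) : ℂ⟦X⟧) := by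
  have han (n : ℕ) (hn : n ≠ 0) (i : I) : AnalyticAt ℂ (fun z => polyLog (P i) (z ^ n)) 0 :=
    AnalyticAt.comp_of_eq (g := polyLog (P i)) (f := fun z => z ^ n)
      ((hP i).differentiableOn_polyLog.analyticAt (ball_mem_nhds 0 one_pos)) (by fun_prop)
      (zero_pow hn)
  have hne (n : ℕ) (hn : n ∈ Finset.Icc 1 N) : n ≠ 0 := by
    have := Finset.mem_Icc.mp hn; omega
  unfold localExponent
  rw [taylorSeries_sum]
  · refine Finset.sum_congr rfl fun n hn => ?_
    rw [taylorSeries_sum]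
    · refine Finset.sum_congr rfl fun i _ => ?_
      rw [taylorSeries_const_mul, (hP i).taylorSeries_polyLog (hne n hn)]
    · exact fun i _ => analyticAt_const.mul (han n (hne n hn) i)
  · exact fun n hn => Finset.analyticAt_fun_sum _ fun i _ =>
      analyticAt_const.mul (han n (hne n hn) i)

/-- The function `q(z) * ∏ n ≤ N, ∏ i, P i (z ^ n) ^ b n i`. -/
def localFactor (q : ℂ → ℂ) (b : ℕ → I → ℂ) (N : ℕ) (P : I → Polynomial ℂ) (z : ℂ) : ℂ :=
  q z * Complex.exp (localExponent b N P z)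

theorem differentiableOn_localFactor {q : ℂ → ℂ} {R : ℝ} (hR : R ≤ 1)
    (hq : DifferentiableOn ℂ q (ball 0 R)) (hP : ∀ i, IsLocalPoly (P i)) :
    DifferentiableOn ℂ (localFactor q b N P) (ball 0 R) :=
  hq.fun_mul ((differentiableOn_localExponent hP).mono (ball_subset_ball hR)).cexp

/-- Terms with `n > N` do not reach degrees up to `N`, so there the truncated exponent cancels `log
q` exactly. Near `0` the principal branch serves as `log q`, because `q 0 = 1`. -/
theorem coeff_taylorSeries_localFactor_eq_zero {q : ℂ → ℂ} (hq : AnalyticAt ℂ q 0)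
    (hq0 : q 0 = 1) (hP : ∀ i, IsLocalPoly (P i))
    (hb : HasSum (fun i : ℕ+ × I => -(b i.1 i.2 •
      logOf (((P i.2).comp (Polynomial.X ^ (i.1 : ℕ)) : Polynomial ℂ) : ℂ⟦X⟧)))
      (logOf (taylorSeries q))) {k : ℕ} (hk : 1 ≤ k) (hkN : k ≤ N) :
    coeff k (taylorSeries (localFactor q b N P)) = 0 := by
  have hslit : q 0 ∈ Complex.slitPlane := by rw [hq0]; exact Complex.one_mem_slitPlane
  have hlog : AnalyticAt ℂ (fun z => Complex.log (q z)) 0 := hq.clog hslit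
  have hexp : AnalyticAt ℂ (localExponent b N P) 0 :=
    (differentiableOn_localExponent hP).analyticAt (ball_mem_nhds 0 one_pos)
  have hne : ∀ᶠ z in nhds 0, q z ≠ 0 :=
    hq.continuousAt.eventually_ne (Complex.slitPlane_ne_zero hslit)
  refine coeff_taylorSeries_exp_eq_zero (hlog.fun_add hexp) ?_ ?_ hk hkN
  · filter_upwards [hne] with z hz
    rw [Complex.exp_add, Complex.exp_log hz, localFactor]
  · intro j hj
    have hL : taylorSeries (fun z => Complex.log (q z)) = logOf (taylorSeries q) :=
      (logOf_taylorSeries hlog (by simp [hq0])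
        (hne.mono fun z hz => Complex.exp_log hz)).symm
    rw [taylorSeries_add hlog hexp, hL, taylorSeries_localExponent hP, map_add, map_sum]
    have h1 := (PowerSeries.WithPiTopology.hasSum_iff_hasSum_coeff ℂ).mp hb j
    have h2 := hasSum_pnat_prod (N := N) (F := fun n i => coeff j (-(b n i •
      logOf (((P i).comp (Polynomial.X ^ n) : Polynomial ℂ) : ℂ⟦X⟧)))) (by
        intro n hn i
        rw [map_neg, coeff_smul, coeff_logOf_comp_X_pow (hP i).eval_zero (by omega) (by omega),
          if_neg (by omega), smul_zero, neg_zero])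
    rw [h1.unique h2]
    simp

end LocalFactor

/-! ### Assembly of part (ii). -/

section Main

open Metric

variable {E : Type*} [Field E] [NumberField E] [IsGalois ℚ E] {Q : Nat.Primes → ℂ → ℂ}
  {S Γ : Nat.Primes → Set ℂ} {r : ℝ}

theorem singularity_radius_mem_Ioc (hQ : ∀ p, IsHolomorphicOnCutDisk (Q p) (S p) (Γ p))
    (hr : IsLeast ({1} ∪ {x : ℝ | ∃ p, ∃ a ∈ S p, ‖a‖ = x}) r) : r ∈ Set.Ioc 0 1 := by
  refine ⟨?_, hr.2 (Or.inl rfl)⟩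
  rcases hr.1 with h | ⟨p, a, ha, rfl⟩
  · rw [Set.mem_singleton_iff.mp h]; exact one_pos
  · refine norm_pos_iff.mpr ?_
    rintro rfl
    exact (hQ p).zero_notMem ((hQ p).sing_subset ha)

/-- A cut point is no closer to `0` than some singularity, so no cut enters the disk of radius `r`.
-/
theorem differentiableOn_ball_singularity_radius
    (hQ : ∀ p, IsHolomorphicOnCutDisk (Q p) (S p) (Γ p))
    (hr : IsLeast ({1} ∪ {x : ℝ | ∃ p, ∃ a ∈ S p, ‖a‖ = x}) r) (p : Nat.Primes) :
    DifferentiableOn ℂ (Q p) (ball 0 r) := by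
  have hr1 := (singularity_radius_mem_Ioc hQ hr).2
  refine (hQ p).differentiableOn.mono fun z hz => ⟨ball_subset_ball hr1 hz, fun hzΓ => ?_⟩
  obtain ⟨a, ha, hle⟩ := (hQ p).outward z hzΓ
  have h1 := hr.2 (Or.inr ⟨p, a, ha, rfl⟩)
  rw [mem_ball_zero_iff] at hz
  linarith

theorem prime_rpow_neg_lt_of_notMem_primesLE {ε : ℝ} (hε : 0 < ε) (hr : 0 < r) {p : Nat.Primes}
    (hp : p ∉ primesLE (r ^ (-1 / ε))) {x : ℝ} (hx : ε ≤ x) : (p : ℝ) ^ (-x) < r := by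
  rw [mem_primesLE, not_le] at hp
  calc (p : ℝ) ^ (-x) ≤ (p : ℝ) ^ (-ε) :=
        Real.rpow_le_rpow_of_exponent_le (one_lt_prime p).le (by linarith)
    _ < (r ^ (-1 / ε)) ^ (-ε) :=
        Real.rpow_lt_rpow_of_neg (Real.rpow_pos_of_pos hr _) hp (by linarith)
    _ = r := by
        rw [← Real.rpow_mul hr.le, show -1 / ε * -ε = 1 by field_simp, Real.rpow_one]

/-- Absolute convergence of the Euler product `∏ p, Q p (p ^ (-s))`. -/
theorem summable_norm_sub_one (hfrob : IsFrobenian E Q) (hQ0 : ∀ p, Q p 0 = 1) (hr : 0 < r)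
    (hdiff : ∀ p, DifferentiableOn ℂ (Q p) (ball 0 r)) {s : ℂ} (hs : 1 < s.re) :
    Summable fun p : Nat.Primes => ‖Q p ((p : ℂ) ^ (-s)) - 1‖ := by
  obtain ⟨T, c, hT, -, hTc⟩ := hfrob
  -- With `N = 0` no coefficient has to vanish, and the exponent condition is just `1 < Re s`.
  have htail := summable_taylorTail hT (frobAbove E) c
    (fun p hp => (hTc p hp).2 _ ⟨_, primeAbove_spec E p, frobAbove_spec E p⟩) hr
    (fun p _ => hdiff p) (N := 0) (fun p _ k h1 h0 => by omega) (x := s.re) (by simpa using hs)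
  refine Summable.of_norm_bounded_eventually htail ?_
  filter_upwards [(summable_prime_rpow_neg hs).tendsto_cofinite_zero.eventually_lt_const hr]
    with p hp
  rw [norm_norm, ← norm_prime_cpow, ← hQ0 p]
  exact norm_sub_le_taylorTail (hdiff p) (by rwa [norm_prime_cpow])

/-- The product of `exp` of the local exponents over all primes. -/
theorem hasProd_exp_localExponent (b : ℕ → IrrChar Gal(E/ℚ) → ℂ) (N : ℕ) {s : ℂ}
    (hs : 1 < s.re) :
    HasProd (fun p : Nat.Primes =>
        Complex.exp (localExponent b N (fun χ => artinPoly χ.rep p) ((p : ℂ) ^ (-s))))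
      (∏ n ∈ Finset.Icc 1 N, ∏ χ, Complex.exp (-b n χ * logArtinL χ.rep (n * s))) := by
  have h : HasSum (fun p : Nat.Primes =>
      localExponent b N (fun χ => artinPoly χ.rep p) ((p : ℂ) ^ (-s)))
      (∑ n ∈ Finset.Icc 1 N, ∑ χ, -b n χ * logArtinL χ.rep (n * s)) := by
    refine hasSum_sum fun n hn => hasSum_sum fun χ _ => ?_
    have hn1 : (1 : ℝ) ≤ n := by exact_mod_cast (Finset.mem_Icc.mp hn).1
    have hre : 1 < ((n : ℂ) * s).re := by
      rw [← Complex.ofReal_natCast, Complex.re_ofReal_mul]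
      nlinarith
    have h1 := (summable_artinLocalLog χ.rep hre).hasSum.mul_left (b n χ)
    rw [logArtinL, neg_mul_neg]
    refine h1.congr_fun fun p => ?_
    rw [artinLocalLog, ← mul_neg, Complex.cpow_nat_mul]
  have h2 := h.cexp
  simp only [Complex.exp_sum] at h2
  exact h2

/-- A family of power series with constant coefficient `1` whose tails are summable over the
primes gives an absolutely convergent Dirichlet series. -/
theorem exists_lseries_of_summable_taylorTail {F : Nat.Primes → ℂ → ℂ} (hF0 : ∀ p, F p 0 = 1)
    {R : Nat.Primes → ℝ} (hF : ∀ p, DifferentiableOn ℂ (F p) (ball 0 (R p))) {ε : ℝ}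
    (hR : ∀ (p : Nat.Primes) (x : ℝ), ε < x → (p : ℝ) ^ (-x) < R p)
    (htail : ∀ x, ε < x → Summable fun p : Nat.Primes => taylorTail (F p) ((p : ℝ) ^ (-x))) :
    ∃ a : ℕ → ℂ, (∀ s : ℂ, ε < s.re → LSeriesSummable a s) ∧
      ∀ s : ℂ, ε < s.re → HasProd (fun p : Nat.Primes => F p ((p : ℂ) ^ (-s))) (LSeries a s) := by
  obtain ⟨φ, hφ, hφ0⟩ : ∃ φ : ℕ → ℕ → ℂ,
      (∀ (p : Nat.Primes) k, φ p k = PowerSeries.coeff k (taylorSeries (F p))) ∧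
      ∀ p, φ p 0 = 1 := by
    -- The default `1` at nonprimes makes `φ p 0 = 1` hold for every natural number.
    refine ⟨fun p k => if hp : p.Prime then PowerSeries.coeff k (taylorSeries (F ⟨p, hp⟩)) else 1,
      fun p k => dif_pos p.2, fun p => ?_⟩
    by_cases hp : p.Prime
    · refine (dif_pos hp).trans ?_
      rw [PowerSeries.coeff_zero_eq_constantCoeff_apply, constantCoeff_taylorSeries]
      exact hF0 _
    · exact dif_neg hp
  have hmain (s : ℂ) (hs : ε < s.re) := lseries_eulerCoeff hφ0 (s := s)
    (fun p => by
      simp only [hφ]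
      exact summable_norm_coeff_taylorSeries (hF p) (by positivity) (hR p _ hs))
    (by
      simp only [hφ]
      exact htail _ hs)
  refine ⟨eulerCoeff φ, fun s hs => (hmain s hs).1, fun s hs => ?_⟩
  refine (hmain s hs).2.congr_fun fun p => ?_
  have h := hasSum_coeff_taylorSeries (hF p) (z := (p : ℂ) ^ (-s))
    (by rw [norm_prime_cpow]; exact hR p _ hs)
  simp only [hφ]
  exact h.tsum_eq.symm

/-- The Dirichlet series of the theorem: for almost all primes its local factors are
`1 + O(p ^ (-(N + 1) * s))`, where `N + 1 > 1 / ε`. -/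
theorem exists_lseries (hfrob : IsFrobenian E Q) (hQ0 : ∀ p, Q p 0 = 1) (hr : r ∈ Set.Ioc 0 1)
    (hdiff : ∀ p, DifferentiableOn ℂ (Q p) (ball 0 r)) {b : ℕ → IrrChar Gal(E/ℚ) → ℂ}
    (hb : IsLogDecomposition E Q b) {ε : ℝ} (hε : 0 < ε) :
    ∃ a : ℕ → ℂ, (∀ s : ℂ, ε < s.re → LSeriesSummable a s) ∧
      ∀ s : ℂ, ε < s.re → HasProd (fun p : Nat.Primes => localFactor
        (if p ∈ primesLE (r ^ (-1 / ε)) then 1 else Q p) b ⌊1 / ε⌋₊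
        (fun χ => artinPoly χ.rep p) ((p : ℂ) ^ (-s))) (LSeries a s) := by
  classical
  obtain ⟨N, hN⟩ : ∃ N, N = ⌊1 / ε⌋₊ := ⟨_, rfl⟩
  obtain ⟨D, hD⟩ : ∃ D, D = primesLE (r ^ (-1 / ε)) := ⟨_, rfl⟩
  rw [← hN, ← hD]
  have hloc (p : Nat.Primes) (χ : IrrChar Gal(E/ℚ)) : IsLocalPoly (artinPoly χ.rep p) :=
    isLocalPoly_artinPoly χ.rep p
  obtain ⟨T, c, hT, -, hTc⟩ := hfrob
  -- Exceptional primes: those in `T` (so all ramified ones), those whose `Q p` is removed, and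
  -- those where the decomposition fails.
  have hA : (T ∪ (D ∪ {p | ¬∀ σ : Gal(E/ℚ), IsFrobeniusOver E p σ →
      HasSum (fun i : ℕ+ × IrrChar Gal(E/ℚ) => -(b i.1 i.2 • PowerSeries.logOf
        (((detOneSub (i.2.rep σ)).comp (Polynomial.X ^ (i.1 : ℕ)) : Polynomial ℂ) :
          PowerSeries ℂ))) (PowerSeries.logOf (taylorSeries (Q p)))})).Finite :=
    hT.union (D.finite_toSet.union (Filter.eventually_cofinite.mp hb))
  have hfr (p : Nat.Primes) : IsFrobeniusOver E p (frobAbove E p) :=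
    ⟨_, primeAbove_spec E p, frobAbove_spec E p⟩
  -- For `p ∈ D` only the Artin factors remain, and these are holomorphic on the whole unit disk.
  refine exists_lseries_of_summable_taylorTail (R := fun p => if p ∈ D then 1 else r)
    (fun p => ?_) (fun p => ?_) (fun p x hx => ?_) fun x hx => ?_
  · rw [localFactor, localExponent_zero, Complex.exp_zero, mul_one]
    split_ifs
    · rfl
    · exact hQ0 p
  · split_ifs
    · exact differentiableOn_localFactor le_rfl (differentiableOn_const 1) (hloc p)
    · exact differentiableOn_localFactor hr.2 (hdiff p) (hloc p)
  · split_ifs with hp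
    · exact prime_rpow_neg_lt_one p (hε.trans hx)
    · rw [hD] at hp
      exact prime_rpow_neg_lt_of_notMem_primesLE hε hr.1 hp hx.le
  · refine summable_taylorTail hA (frobAbove E)
      (fun g => localFactor (c g) b N fun χ => detOneSub (χ.rep g)) (fun p hp => ?_) hr.1
      (fun p hp => ?_) (N := N) (fun p hp k hk hkN => ?_) ?_
    · simp only [Set.mem_union, Finset.mem_coe, not_or] at hp
      obtain ⟨hunr, hc⟩ := hTc p hp.1
      rw [if_neg hp.2.1, hc _ (hfr p)]
      simp only [artinPoly_eq_of_isUnramifiedIn _ hunr]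
    · simp only [Set.mem_union, Finset.mem_coe, not_or] at hp
      rw [if_neg hp.2.1]
      exact differentiableOn_localFactor hr.2 (hdiff p) (hloc p)
    · simp only [Set.mem_union, Finset.mem_coe, not_or] at hp
      rw [if_neg hp.2.1]
      refine coeff_taylorSeries_localFactor_eq_zero
        ((hdiff p).analyticAt (ball_mem_nhds 0 hr.1)) (hQ0 p) (hloc p) ?_ hk hkN
      simp only [artinPoly_eq_of_isUnramifiedIn _ (hTc p hp.1).1]
      exact not_not.mp hp.2.2 (frobAbove E p) (hfr p)
    -- This is where the cutoff `⌊1 / ε⌋` matters: `(N + 1) * ε > 1`, hence `x * (N + 1) > 1`.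
    · have h1 : 1 / ε < N + 1 := by rw [hN]; exact Nat.lt_floor_add_one (1 / ε)
      rw [div_lt_iff₀ hε] at h1
      nlinarith

theorem hasProd_ite_of_multipliable_compl {ι : Type*} [DecidableEq ι] {f : ι → ℂ} {D : Finset ι}
    (h : Multipliable fun i : {i // i ∉ D} => f i) :
    HasProd (fun i => if i ∈ D then 1 else f i) (∏' i : {i // i ∉ D}, f i) := by
  have h1 := (hasProd_subtype_iff_mulIndicator (f := f) (s := {i | i ∉ D})).mp h.hasProd
  refine h1.congr_fun fun i => ?_
  by_cases hi : i ∈ D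
  · rw [if_pos hi, Set.mulIndicator_of_notMem (by simpa using hi)]
  · rw [if_neg hi, Set.mulIndicator_of_mem (by simpa using hi)]

/-- Factors indexed by `D` may vanish here; nonvanishing is needed only to divide by them
afterwards. -/
theorem tprod_eq_prod_mul_tprod_compl {ι : Type*} {f : ι → ℂ} {D : Finset ι}
    (h : Multipliable fun i : {i // i ∉ D} => f i) :
    ∏' i, f i = (∏ i ∈ D, f i) * ∏' i : {i // i ∉ D}, f i :=
  (HasProd.mul_compl (f := f) (s := (D : Set ι)) (D.hasProd f) h.hasProd).tprod_eq

end Main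

end FrobEuler

end

theorem mainTheorem4 (E : Type*) [Field E] [NumberField E] [IsGalois ℚ E]
    (Q : Nat.Primes → ℂ → ℂ) (hfrob : FrobEuler.IsFrobenian E Q)
    (S Γ : Nat.Primes → Set ℂ)
    (hQ : ∀ p, FrobEuler.IsHolomorphicOnCutDisk (Q p) (S p) (Γ p))
    (hQ0 : ∀ p, Q p 0 = 1)
    -- `r` is the smallest magnitude of a singularity, and `r = 1` if there are none
    (r : ℝ) (hr : IsLeast ({1} ∪ {x : ℝ | ∃ p, ∃ a ∈ S p, ‖a‖ = x}) r) :
    -- (i)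
    (∃ b : ℕ → FrobEuler.IrrChar Gal(E/ℚ) → ℂ, FrobEuler.IsLogDecomposition E Q b) ∧
    -- (ii)
    ∃ ℓ : FrobEuler.IrrChar Gal(E/ℚ) → ℂ → ℂ,
      (∀ χ, FrobEuler.IsLogArtinL χ.rep (ℓ χ)) ∧
      ∀ b : ℕ → FrobEuler.IrrChar Gal(E/ℚ) → ℂ, FrobEuler.IsLogDecomposition E Q b →
      ∀ ε : ℝ, 0 < ε → ∃ a : ℕ → ℂ,
        (∀ s : ℂ, ε < s.re → LSeriesSummable a s) ∧
        DifferentiableOn ℂ (LSeries a) {s | ε < s.re} ∧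
        ∀ s : ℂ, 1 < s.re → ε < s.re →
          -- the Euler product converges absolutely
          (Summable fun p : Nat.Primes => ‖Q p ((p : ℂ) ^ (-s)) - 1‖) ∧
          (Multipliable fun p : Nat.Primes => Q p ((p : ℂ) ^ (-s))) ∧
          -- the product with the factors at `p ≤ r ^ (-1/ε)` removed
          (∏' p : {p : Nat.Primes // p ∉ FrobEuler.primesLE (r ^ (-1 / ε))},
              Q p ((p : ℂ) ^ (-s))) *
            ∏ n ∈ Finset.Icc 1 ⌊1 / ε⌋₊, ∏ χ, Complex.exp (-b n χ * ℓ χ (n * s)) =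
            LSeries a s ∧
          -- the same with the full product divided by these factors, where they are nonzero
          ((∀ p ∈ FrobEuler.primesLE (r ^ (-1 / ε)), Q p ((p : ℂ) ^ (-s)) ≠ 0) →
            (∏' p : Nat.Primes, Q p ((p : ℂ) ^ (-s))) *
              (∏ p ∈ FrobEuler.primesLE (r ^ (-1 / ε)), (Q p ((p : ℂ) ^ (-s)))⁻¹) *
              ∏ n ∈ Finset.Icc 1 ⌊1 / ε⌋₊, ∏ χ, Complex.exp (-b n χ * ℓ χ (n * s)) =
              LSeries a s) := by
  have hr01 := FrobEuler.singularity_radius_mem_Ioc hQ hr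
  have hdiff := FrobEuler.differentiableOn_ball_singularity_radius hQ hr
  refine ⟨FrobEuler.exists_isLogDecomposition E Q hfrob hQ0,
    fun χ => FrobEuler.logArtinL χ.rep, fun χ => FrobEuler.isLogArtinL_logArtinL χ.rep,
    fun b hb ε hε => ?_⟩
  obtain ⟨a, hsum, hprod⟩ := FrobEuler.exists_lseries hfrob hQ0 hr01 hdiff hb hε
  refine ⟨a, hsum, ?_, fun s hs1 hsε => ?_⟩
  · have habs := LSeries.abscissaOfAbsConv_le_of_forall_lt_LSeriesSummable (f := a) (x := ε)
      fun y hy => hsum y (by simpa using hy)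
    refine (LSeries_differentiableOn a).mono fun s hs => ?_
    exact habs.trans_lt (EReal.coe_lt_coe_iff.mpr hs)
  have hnorm := FrobEuler.summable_norm_sub_one hfrob hQ0 hr01.1 hdiff hs1
  have hmul {I : Type} (i : I → Nat.Primes) (hi : Function.Injective i) :
      Multipliable fun x => Q (i x) (((i x : ℕ) : ℂ) ^ (-s)) := by
    have h := multipliable_one_add_of_summable (hnorm.comp_injective hi)
    simpa [Function.comp_def] using h
  have hQmul := hmul id Function.injective_id
  have hDmul := hmul (fun p : {p : Nat.Primes // p ∉ FrobEuler.primesLE (r ^ (-1 / ε))} => p.1)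
    Subtype.val_injective
  have hexp := FrobEuler.hasProd_exp_localExponent b ⌊1 / ε⌋₊ hs1
  -- The product of the two Euler products and the product of the local factors have the same terms,
  -- so their values agree by uniqueness of limits.
  have hfirst := ((FrobEuler.hasProd_ite_of_multipliable_compl
    (f := fun p : Nat.Primes => Q p ((p : ℂ) ^ (-s))) hDmul).mul hexp).unique
    ((hprod s hsε).congr_fun fun p => by
      rw [FrobEuler.localFactor]
      congr 1
      split_ifs <;> rfl)
  refine ⟨hnorm, hQmul, hfirst, fun hne => ?_⟩
  rw [← hfirst, FrobEuler.tprod_eq_prod_mul_tprod_compl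
    (f := fun p : Nat.Primes => Q p ((p : ℂ) ^ (-s))) hDmul, Finset.prod_inv_distrib]
  congr 1
  rw [mul_right_comm, mul_inv_cancel₀ (Finset.prod_ne_zero_iff.mpr hne), one_mul]
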